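/- Notation. $(x,y)$ is the greatest common divisor; $\mu$ the Möbius function; $\phi$ Euler's totient; $J_k(q)=q^k\prod_{p\mid q}(1-p^{-k})$ (product over the primes $p\mid q$) Jordan's totient; $B_n$ and $B_n(x)$ are the Bernoulli numbers and polynomials; $\{x\}$ is the fractional part of $x$; $\delta_{1,m}$ is the Kronecker delta; $\delta_{\mathbb Z}(x)=1$ if $x\in\mathbb Z$ and $0$ otherwise. The Bernoulli functions on $\mathbb R$ are $\overline B_0(x)=1$, $\overline B_1(x)=0$ if $x\in\mathbb Z$ and $\overline B_1(x)=B_1(\{x\})$ if $x\notin\mathbb Z$, and $\overline B_n(x)=B_n(\{x\})$ for $n\ge 2$. $L(s,\chi)$ is the Dirichlet $L$-function of $\chi$ (analytically continued), and $\overline\chi$ is the complex conjugate character. Theorem. Let $q,m_1,m_2,m_3,a,b,c$ be positive integers with $q\ge 2$, $m_3\ge2$, $m_1+m_2\equiv m_3\pmod 2$ and $(a,q)=(b,q)=(c,q)=1$, and set $$V=\sum_{\substack{\chi_1,\chi_2\ (\mathrm{mod}\ q)\\ \chi_1(-1)=(-1)^{m_1},\ \chi_2(-1)=(-1)^{m_2}}}\chi_1(a)\chi_2(b)\overline{\chi_1\chi_2}(c)\,L(m_1,\chi_1)L(m_2,\chi_2)L(m_3,\overline{\chi_1\chi_2}).$$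 Then, with $M=m_1+m_2+m_3$, $$\begin{aligned}V={}&\frac{(-1)^{\frac{m_1-m_2-m_3}{2}}(2\pi)^{M}(b,c)^{m_2+m_3}\phi(q)^2}{8q^{M}b^{m_3}c^{m_2}\,m_1!\,(m_2+m_3)!}\Bigl(R\bigl(m_1,m_2+m_3,q;a,\tfrac{bc}{(b,c)}\bigr)+R\bigl(m_2+m_3,m_1,q;\tfrac{bc}{(b,c)},a\bigr)\Bigr)\\ &-\frac{(-1)^{\frac{m_1+m_2-m_3}{2}}(2\pi)^{M}\phi(q)^2}{8q^{M}\,m_1!\,m_2!\,m_3!}\Bigl(A_{m_1,m_2,m_3,q}(a,b,c)+(-1)^{m_1}A_{m_1,m_3,m_2,q}(a,c,b)\\ &\quad+B_{m_1,m_2,m_3,q}(a,b,c)+(-1)^{m_1}B_{m_1,m_3,m_2,q}(a,c,b)+C_{m_1,m_2,m_3,q}(a,b,c)+(-1)^{m_1}C_{m_1,m_3,m_2,q}(a,c,b)\\ &\quad-D_{m_1,m_2,m_3,q}(b,c)+D_{m_1,m_3,m_2,q}(c,b)+C_2\Bigr),\end{aligned}$$ where $$R(m,n,q;a,b)=nb^{n-1}\sum_{j=0}^{m}\binom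 mj\frac{(-1)^ja^{m-j}}{m+n-j}\sum_{l=1}^{b}\overline B_j\Bigl(\frac{al}{b}\Bigr)\sum_{d\mid q}\mu\Bigl(\frac qd\Bigr)d^{j}\,\overline B_{m+n-j}\Bigl(\frac{dl}{b}\Bigr),$$ $$\begin{aligned}A_{m_1,m_2,m_3,q}(a,b,c)={}&m_3b^{m_2-1}c^{m_3-1}\sum_{j=1}^{m_2}\binom{m_2}{j}\frac{(-1)^jj}{m_2+m_3-j}\sum_{j_1=0}^{m_1}\binom{m_1}{j_1}\frac{(-1)^{j_1}a^{m_1-j_1}}{m_1+j-j_1}\sum_{l=1}^{c}\sum_{l_1=1}^{b}\overline B_{j_1}\Bigl(\frac{al_1}{b}+\frac{al}{c}\Bigr)\\&\times\sum_{d\mid q}\mu\Bigl(\frac qd\Bigr)d^{j_1}\,\overline B_{m_2+m_3-j}\Bigl(\frac{dl}{c}\Bigr)\overline B_{m_1+j-j_1}\Bigl(\frac{dl_1}{b}+\frac{dl}{c}\Bigr),\end{aligned}$$ $$\begin{aligned}B_{m_1,m_2,m_3,q}(a,b,c)={}&m_1m_2a^{m_1-1}b^{m_2-1}\sum_{j=1}^{m_3}\binom{m_3}{j}\frac{1}{m_2+m_3-j}\sum_{j_1=0}^{j}\binom{j}{j_1}\frac{(-1)^{j_1}c^{m_3-j_1}}{m_1+j-j_1}\sum_{l=1}^{b}\sum_{l_1=1}^{a}\overline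 B_{j_1}\Bigl(\frac{cl_1}{a}+\frac{cl}{b}\Bigr)\\&\times\sum_{d\mid q}\mu\Bigl(\frac qd\Bigr)d^{j_1}\,\overline B_{m_2+m_3-j}\Bigl(\frac{dl}{b}\Bigr)\overline B_{m_1+j-j_1}\Bigl(\frac{dl_1}{a}\Bigr),\end{aligned}$$ $$\begin{aligned}C_{m_1,m_2,m_3,q}(a,b,c)={}&-\frac{m_2\,m_1!\,b^{m_2-1}(a,c)^{m_1}}{c^{m_1}}\sum_{j=1}^{m_3}\binom{m_3}{j}\frac{(-1)^j(a,c)^jc^{m_3-j}j!}{a^j(m_2+m_3-j)(m_1+j)!}\sum_{l=1}^{b}\overline B_{m_1+j}\Bigl(\frac{ac}{(a,c)}\cdot\frac{l}{b}\Bigr)\\&\times\sum_{d\mid q}\mu\Bigl(\frac qd\Bigr)d^{m_1+j}\,\overline B_{m_2+m_3-j}\Bigl(\frac{dl}{b}\Bigr),\end{aligned}$$ $$D_{m_1,m_2,m_3,q}(b,c)=\frac{\delta_{1,m_1}m_2m_3b^{m_2-1}c^{m_3-1}}{4(m_2+m_3-1)}\sum_{d\mid q}\mu\Bigl(\frac qd\Bigr)d^{m_1}\sum_{l=1}^{b}\overline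 B_{m_2+m_3-1}\Bigl(\frac{dl}{b}\Bigr)\delta_{\mathbb Z}\Bigl(\frac{cl}{b}\Bigr),$$ $$C_2=\frac{(-1)^{m_1+m_2}m_1!\,m_2!\,m_3!\,\bigl(a(b,c),bc\bigr)^{M}B_{M}J_{M}(q)}{a^{m_2+m_3}b^{m_1+m_3}c^{m_1+m_2}\,M!}.$$ -/

import Mathlib

/-- The `n`-th Bernoulli function `B̄ₙ : ℝ → ℝ`: it is `Bₙ({x})`, except that `B̄₁` is `0` at the
integers. In particular `B̄₀ = 1`. -/
noncomputable def bernoulliBar (n : ℕ) (x : ℝ) : ℝ :=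
  if n = 1 ∧ Int.fract x = 0 then 0 else bernoulliFun n (Int.fract x)

/-- Jordan's totient `J_k(q) = q ^ k * ∏_{p ∣ q} (1 - 1 / p ^ k)`, as a real number. -/
noncomputable def jordanJ (k q : ℕ) : ℝ :=
  (q : ℝ) ^ k * ∏ p ∈ q.primeFactors, (1 - 1 / (p : ℝ) ^ k)

open Classical in
/-- The indicator function of `ℤ` inside `ℝ`. -/
noncomputable def deltaInt (x : ℝ) : ℝ := if ∃ k : ℤ, (k : ℝ) = x then 1 else 0

/-- The triple mean value: the sum over all pairs of Dirichlet characters `χ₁, χ₂` modulo `q` with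
`χ₁(-1) = (-1) ^ m₁` and `χ₂(-1) = (-1) ^ m₂`. Here `star` is complex conjugation of characters and
`LFunction` is the analytically continued Dirichlet `L`-function (this matters only at `s = 1`). -/
noncomputable def tripleMean (q : ℕ) [NeZero q] (m₁ m₂ m₃ a b c : ℕ) : ℂ :=
  ∑ χ₁ : DirichletCharacter ℂ q with χ₁ (-1) = (-1) ^ m₁,
    ∑ χ₂ : DirichletCharacter ℂ q with χ₂ (-1) = (-1) ^ m₂,
      χ₁ (a : ZMod q) * χ₂ (b : ZMod q) * (star (χ₁ * χ₂)) (c : ZMod q) *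
        DirichletCharacter.LFunction χ₁ m₁ * DirichletCharacter.LFunction χ₂ m₂ *
        DirichletCharacter.LFunction (star (χ₁ * χ₂)) m₃

/-- `R(m, n, q; a, b)`. -/
noncomputable def sumR (m n q a b : ℕ) : ℝ :=
  (n : ℝ) * (b : ℝ) ^ (n - 1) *
    ∑ j ∈ Finset.range (m + 1),
      (m.choose j : ℝ) * ((-1 : ℝ) ^ j * (a : ℝ) ^ (m - j) / ((m : ℝ) + n - j)) *
        ∑ l ∈ Finset.Icc 1 b, bernoulliBar j ((a : ℝ) * l / b) *
          ∑ d ∈ q.divisors, (ArithmeticFunction.moebius (q / d) : ℝ) * (d : ℝ) ^ j *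
            bernoulliBar (m + n - j) ((d : ℝ) * l / b)

/-- `A_{m₁, m₂, m₃, q}(a, b, c)`. -/
noncomputable def sumA (m₁ m₂ m₃ q a b c : ℕ) : ℝ :=
  (m₃ : ℝ) * (b : ℝ) ^ (m₂ - 1) * (c : ℝ) ^ (m₃ - 1) *
    ∑ j ∈ Finset.Icc 1 m₂,
      (m₂.choose j : ℝ) * ((-1 : ℝ) ^ j * (j : ℝ) / ((m₂ : ℝ) + m₃ - j)) *
        ∑ j₁ ∈ Finset.range (m₁ + 1),
          (m₁.choose j₁ : ℝ) * ((-1 : ℝ) ^ j₁ * (a : ℝ) ^ (m₁ - j₁) / ((m₁ : ℝ) + j - j₁)) *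
            ∑ l ∈ Finset.Icc 1 c, ∑ l₁ ∈ Finset.Icc 1 b,
              bernoulliBar j₁ ((a : ℝ) * l₁ / b + (a : ℝ) * l / c) *
                ∑ d ∈ q.divisors, (ArithmeticFunction.moebius (q / d) : ℝ) * (d : ℝ) ^ j₁ *
                  bernoulliBar (m₂ + m₃ - j) ((d : ℝ) * l / c) *
                  bernoulliBar (m₁ + j - j₁) ((d : ℝ) * l₁ / b + (d : ℝ) * l / c)

/-- `B_{m₁, m₂, m₃, q}(a, b, c)`. -/
noncomputable def sumB (m₁ m₂ m₃ q a b c : ℕ) : ℝ :=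
  (m₁ : ℝ) * (m₂ : ℝ) * (a : ℝ) ^ (m₁ - 1) * (b : ℝ) ^ (m₂ - 1) *
    ∑ j ∈ Finset.Icc 1 m₃,
      (m₃.choose j : ℝ) * (1 / ((m₂ : ℝ) + m₃ - j)) *
        ∑ j₁ ∈ Finset.range (j + 1),
          (j.choose j₁ : ℝ) * ((-1 : ℝ) ^ j₁ * (c : ℝ) ^ (m₃ - j₁) / ((m₁ : ℝ) + j - j₁)) *
            ∑ l ∈ Finset.Icc 1 b, ∑ l₁ ∈ Finset.Icc 1 a,
              bernoulliBar j₁ ((c : ℝ) * l₁ / a + (c : ℝ) * l / b) *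
                ∑ d ∈ q.divisors, (ArithmeticFunction.moebius (q / d) : ℝ) * (d : ℝ) ^ j₁ *
                  bernoulliBar (m₂ + m₃ - j) ((d : ℝ) * l / b) *
                  bernoulliBar (m₁ + j - j₁) ((d : ℝ) * l₁ / a)

/-- `C_{m₁, m₂, m₃, q}(a, b, c)`. The division `a * c / a.gcd c` is exact. -/
noncomputable def sumC (m₁ m₂ m₃ q a b c : ℕ) : ℝ :=
  -((m₂ : ℝ) * (m₁.factorial : ℝ) * (b : ℝ) ^ (m₂ - 1) * (a.gcd c : ℝ) ^ m₁ / (c : ℝ) ^ m₁) *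
    ∑ j ∈ Finset.Icc 1 m₃,
      (m₃.choose j : ℝ) *
        ((-1 : ℝ) ^ j * (a.gcd c : ℝ) ^ j * (c : ℝ) ^ (m₃ - j) * (j.factorial : ℝ) /
          ((a : ℝ) ^ j * ((m₂ : ℝ) + m₃ - j) * ((m₁ + j).factorial : ℝ))) *
        ∑ l ∈ Finset.Icc 1 b,
          bernoulliBar (m₁ + j) (((a * c / a.gcd c : ℕ) : ℝ) * l / b) *
            ∑ d ∈ q.divisors, (ArithmeticFunction.moebius (q / d) : ℝ) * (d : ℝ) ^ (m₁ + j) *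
              bernoulliBar (m₂ + m₃ - j) ((d : ℝ) * l / b)

/-- `D_{m₁, m₂, m₃, q}(b, c)`. -/
noncomputable def sumD (m₁ m₂ m₃ q b c : ℕ) : ℝ :=
  (if m₁ = 1 then 1 else 0) * (m₂ : ℝ) * (m₃ : ℝ) * (b : ℝ) ^ (m₂ - 1) * (c : ℝ) ^ (m₃ - 1) /
      (4 * ((m₂ : ℝ) + m₃ - 1)) *
    ∑ d ∈ q.divisors, (ArithmeticFunction.moebius (q / d) : ℝ) * (d : ℝ) ^ m₁ *
      ∑ l ∈ Finset.Icc 1 b,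
        bernoulliBar (m₂ + m₃ - 1) ((d : ℝ) * l / b) * deltaInt ((c : ℝ) * l / b)

/-- The constant `C₂`. -/
noncomputable def constC₂ (m₁ m₂ m₃ q a b c : ℕ) : ℝ :=
  (-1 : ℝ) ^ (m₁ + m₂) * (m₁.factorial : ℝ) * (m₂.factorial : ℝ) * (m₃.factorial : ℝ) *
      ((a * b.gcd c).gcd (b * c) : ℝ) ^ (m₁ + m₂ + m₃) *
      (bernoulli (m₁ + m₂ + m₃) : ℝ) * jordanJ (m₁ + m₂ + m₃) q /
    ((a : ℝ) ^ (m₂ + m₃) * (b : ℝ) ^ (m₁ + m₃) * (c : ℝ) ^ (m₁ + m₂) *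
      ((m₁ + m₂ + m₃).factorial : ℝ))

/-! For a character `χ` of parity `(-1)^m`, Hurwitz's formula gives `χ(a) L(m, χ) = -(2πi)^m / (2 m!
q) * ∑ χ(k) 𝓕β(k)`, where `β(j)` is the Bernoulli function `B̄ₘ(aj/q)` on `ZMod q`
(`apply_mul_LFunction_eq`). For the wrong parity the sum over `k` vanishes, so the parity conditions
on `χ₁, χ₂` can be dropped. Orthogonality then leaves `φ(q)²` times the sum over units `k` of a
product of three Fourier transforms at `k` (`sum_sum_characters_eq`).

Möbius inversion replaces the units by the multiples of `q/d`, for `d ∣ q`. The distribution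
relation of Bernoulli functions lowers the level from `q` to `d` (`dft_bernoulliZMod_mul`), and the
convolution theorem turns the sum over level `d` into the triple Dedekind sum `∑ B̄_{m₁}(ar/d)
B̄_{m₂}(bs/d) B̄_{m₃}(c(s+r)/d)` over `r, s` mod `d` (`tripleMean_eq_sum_divisors`).

What remains is a reciprocity law for that sum (`tripleDedekindSum_reciprocity`). It rests on the
formula expanding a product `B̄ₘ(x) B̄ₙ(y)` in the products `B̄ⱼ(x-y) B̄_{m+n-j}(y)` and `B̄ⱼ(y-x)
B̄_{m+n-j}(x)` (`bernoulliBar_mul`), from which the distribution relation yields Dedekind–Rademacher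
reciprocity. That law is applied to the sum over `s`, and again to each resulting sum over `r`
against `B̄_{m₁}(ar/d)`. After weighting by `μ(q/d)`, terms independent of `d` cancel because `q ≥
2`, and the term in `d^M` produces Jordan's totient. -/

/-! ### Product formula for Bernoulli polynomials and Bernoulli functions. -/

/-- The forward difference of a Bernoulli polynomial. -/
theorem bernoulliFun_add_one (k : ℕ) (y : ℝ) :
    bernoulliFun k (y + 1) = bernoulliFun k y + k * y ^ (k - 1) := by
  simpa [bernoulliFun, Polynomial.aeval_comp, add_comm (1 : ℝ) y]
    using congr_arg (·.aeval y) (Polynomial.bernoulli_comp_one_add_X k)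

/-- Both sides are `(-1)^n Bₙ(-y)`: the left by expansion in Bernoulli numbers, the right by the
reflection formula. -/
theorem sum_choose_neg_one_pow_mul_bernoulliFun_zero (n : ℕ) (y : ℝ) :
    ∑ j ∈ Finset.range (n + 1), (n.choose j : ℝ) * ((-1) ^ j * bernoulliFun j 0 * y ^ (n - j)) =
      bernoulliFun n y + n * y ^ (n - 1) := by
  have h2 : bernoulliFun n (-y) = (-1) ^ n * (bernoulliFun n y + n * y ^ (n - 1)) := by
    rw [mul_add]
    simpa [bernoulliFun, Polynomial.aeval_comp]
      using congr_arg (·.aeval y) (Polynomial.bernoulli_comp_neg_X n)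
  have h3 : bernoulliFun n (-y) =
      ∑ j ∈ Finset.range (n + 1), (n.choose j : ℝ) * (bernoulliFun j 0 * (-y) ^ (n - j)) := by
    simp only [bernoulliFun_eval_zero]
    rw [bernoulliFun, Polynomial.bernoulli]
    simp only [Polynomial.map_sum, Polynomial.eval_finsetSum, Polynomial.map_monomial,
      Polynomial.eval_monomial]
    refine Finset.sum_congr rfl fun j _ => ?_
    simp; ring
  have hs : ((-1 : ℝ) ^ n) * (-1) ^ n = 1 := by rw [← mul_pow]; simp
  have : bernoulliFun n y + n * y ^ (n - 1) = (-1) ^ n * bernoulliFun n (-y) := by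
    rw [h2, ← mul_assoc, hs, one_mul]
  rw [this, h3, Finset.mul_sum]
  refine Finset.sum_congr rfl fun j hj => ?_
  have hj' : j ≤ n := Nat.lt_succ_iff.mp (Finset.mem_range.mp hj)
  obtain ⟨i, rfl⟩ := Nat.exists_eq_add_of_le hj'
  rw [Nat.add_sub_cancel_left, neg_pow y i, pow_add]
  have : ((-1 : ℝ) ^ i) * (-1) ^ i = 1 := by rw [← mul_pow]; simp
  linear_combination (-((j + i).choose j : ℝ) * (-1) ^ j * bernoulliFun j 0 * y ^ i) * this

/-- The difference of the two sides of the product formula for `B_m(y + z) * B_n(y)`. -/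
noncomputable def bernoulliProductDefect (m n : ℕ) (y z : ℝ) : ℝ :=
  bernoulliFun m (y + z) * bernoulliFun n y -
    ∑ j ∈ Finset.range (m + 1), (m.choose j : ℝ) * ((n : ℝ) / ((m : ℝ) + n - j)) *
      (bernoulliFun j z * bernoulliFun (m + n - j) y) -
    ∑ j ∈ Finset.range (n + 1), (n.choose j : ℝ) * ((m : ℝ) / ((m : ℝ) + n - j)) *
      ((-1) ^ j * (bernoulliFun j z * bernoulliFun (m + n - j) (y + z))) +
    (-1) ^ n * ((m.factorial : ℝ) * n.factorial / (m + n).factorial) * bernoulliFun (m + n) z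

theorem hasDerivAt_bernoulliFun_const_add (k : ℕ) (y z : ℝ) :
    HasDerivAt (fun z => bernoulliFun k (y + z)) (k * bernoulliFun (k - 1) (y + z)) z := by
  simpa using (hasDerivAt_bernoulliFun k (y + z)).comp_const_add y z

theorem succ_mul_choose_succ_cast (n i : ℕ) :
    (n.choose (i + 1) : ℝ) * ((i : ℝ) + 1) = n.choose i * ((n : ℝ) - i) := by
  rcases le_or_gt i n with h | h
  · have := Nat.choose_succ_right_eq n i
    have h2 : ((n - i : ℕ) : ℝ) = (n : ℝ) - i := by push_cast [h]; ring
    rw [← h2]; exact_mod_cast this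
  · rw [Nat.choose_eq_zero_of_lt h, Nat.choose_eq_zero_of_lt (by omega)]; simp

/-- The defect behaves like an Appell sequence in `z`. In the second sum, differentiating
`B_{m+1+n-j}(y+z)` cancels the denominator, and differentiating `Bⱼ(z)` gives, after an index shift,
the same products with weight `-(m+1)(n-j)/(m+n-j)`; together they have weight `(m+1)m/(m+n-j)`. -/
theorem hasDerivAt_bernoulliProductDefect (m : ℕ) {n : ℕ} (hn : 1 ≤ n) (y z : ℝ) :
    HasDerivAt (bernoulliProductDefect (m + 1) n y)
      (if m = 0 then 0 else (m + 1) * bernoulliProductDefect m n y z) z := by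
  have e1 := (hasDerivAt_bernoulliFun_const_add (m + 1) y z).mul_const (bernoulliFun n y)
  have e2 := HasDerivAt.fun_sum (u := Finset.range (m + 1 + 1)) fun j (_ : j ∈ _) =>
    (((hasDerivAt_bernoulliFun j z).mul_const (bernoulliFun (m + 1 + n - j) y)).const_mul
      (((m + 1).choose j : ℝ) * ((n : ℝ) / (((m + 1 : ℕ) : ℝ) + n - j))))
  have e3 := HasDerivAt.fun_sum (u := Finset.range (n + 1)) fun j (_ : j ∈ _) =>
    ((((hasDerivAt_bernoulliFun j z).mul
      (hasDerivAt_bernoulliFun_const_add (m + 1 + n - j) y z)).const_mul ((-1 : ℝ) ^ j)).const_mul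
      ((n.choose j : ℝ) * (((m + 1 : ℕ) : ℝ) / (((m + 1 : ℕ) : ℝ) + n - j))))
  have e4 := (hasDerivAt_bernoulliFun (m + 1 + n) z).const_mul
    ((-1 : ℝ) ^ n * (((m + 1).factorial : ℝ) * n.factorial / (m + 1 + n).factorial))
  have e := ((e1.sub e2).sub e3).add e4
  refine HasDerivAt.congr_deriv (f' := _) (by simpa only [bernoulliProductDefect] using! e) ?_
  have s2 : ∑ j ∈ Finset.range (m + 1 + 1),
      ((m + 1).choose j : ℝ) * ((n : ℝ) / (((m + 1 : ℕ) : ℝ) + n - j)) *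
        ((j : ℝ) * bernoulliFun (j - 1) z * bernoulliFun (m + 1 + n - j) y) =
      (m + 1) * ∑ j ∈ Finset.range (m + 1), (m.choose j : ℝ) * ((n : ℝ) / ((m : ℝ) + n - j)) *
      (bernoulliFun j z * bernoulliFun (m + n - j) y) := by
    rw [Finset.sum_range_succ', Finset.mul_sum]
    simp only [Nat.cast_zero, zero_mul, mul_zero, add_zero]
    refine Finset.sum_congr rfl fun j _ => ?_
    have h : ((m + 1).choose (j + 1) : ℝ) * (j + 1) = (m + 1) * m.choose j := by
      exact_mod_cast (Nat.add_one_mul_choose_eq m j).symm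
    rw [show m + 1 + n - (j + 1) = m + n - j by omega, Nat.add_sub_cancel]
    push_cast
    rw [show (m : ℝ) + 1 + n - (j + 1) = m + n - j by ring]
    linear_combination ((n : ℝ) / ((m : ℝ) + n - j)) * bernoulliFun j z *
      bernoulliFun (m + n - j) y * h
  have s3 : ∑ j ∈ Finset.range (n + 1),
      (n.choose j : ℝ) * (((m + 1 : ℕ) : ℝ) / (((m + 1 : ℕ) : ℝ) + n - j)) * ((-1 : ℝ) ^ j *
        ((j : ℝ) * bernoulliFun (j - 1) z * bernoulliFun (m + 1 + n - j) (y + z) +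
        bernoulliFun j z * (((m + 1 + n - j : ℕ) : ℝ) *
          bernoulliFun (m + 1 + n - j - 1) (y + z)))) =
      (m + 1) * (∑ j ∈ Finset.range (n + 1), (n.choose j : ℝ) *
        ((m : ℝ) / ((m : ℝ) + n - j)) *
        ((-1) ^ j * (bernoulliFun j z * bernoulliFun (m + n - j) (y + z))) +
        if m = 0 then (-1) ^ n * bernoulliFun n z else 0) := by
    have h1 : ∀ j ∈ Finset.range (n + 1),
        (n.choose j : ℝ) * (((m + 1 : ℕ) : ℝ) / (((m + 1 : ℕ) : ℝ) + n - j)) * ((-1 : ℝ) ^ j *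
        ((j : ℝ) * bernoulliFun (j - 1) z * bernoulliFun (m + 1 + n - j) (y + z) +
        bernoulliFun j z * (((m + 1 + n - j : ℕ) : ℝ) *
          bernoulliFun (m + 1 + n - j - 1) (y + z)))) =
        (n.choose j : ℝ) * ((m + 1) / (((m : ℝ) + 1) + n - j)) * ((-1 : ℝ) ^ j *
        ((j : ℝ) * bernoulliFun (j - 1) z * bernoulliFun (m + 1 + n - j) (y + z))) +
        (m + 1) * ((n.choose j : ℝ) * ((-1) ^ j *
          (bernoulliFun j z * bernoulliFun (m + n - j) (y + z)))) := by
      intro j hj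
      have hj' : j ≤ n := Nat.lt_succ_iff.mp (Finset.mem_range.mp hj)
      have hc : ((m + 1 + n - j : ℕ) : ℝ) = (m : ℝ) + 1 + n - j := by
        push_cast [show j ≤ m + 1 + n by omega]; ring
      have h0 : (m : ℝ) + 1 + n - j ≠ 0 := by
        rw [← hc]; exact_mod_cast (by omega : m + 1 + n - j ≠ 0)
      rw [hc, show m + 1 + n - j - 1 = m + n - j by omega]
      push_cast
      field_simp
    rw [Finset.sum_congr rfl h1, Finset.sum_add_distrib, Finset.sum_range_succ']
    have h2 : ∑ j ∈ Finset.range n, ((n.choose (j + 1) : ℝ) *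
        ((m + 1) / (((m : ℝ) + 1) + n - (j + 1 : ℕ))) * ((-1 : ℝ) ^ (j + 1) *
        (((j + 1 : ℕ) : ℝ) * bernoulliFun (j + 1 - 1) z *
          bernoulliFun (m + 1 + n - (j + 1)) (y + z)))) =
        ∑ j ∈ Finset.range (n + 1), -((m : ℝ) + 1) * (n.choose j * ((n - j) / ((m : ℝ) + n - j)) *
          ((-1 : ℝ) ^ j * (bernoulliFun j z * bernoulliFun (m + n - j) (y + z)))) := by
      rw [Finset.sum_range_succ]
      simp only [sub_self, zero_div, mul_zero, zero_mul, add_zero]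
      refine Finset.sum_congr rfl fun j _ => ?_
      rw [show m + 1 + n - (j + 1) = m + n - j by omega, Nat.add_sub_cancel]
      have := succ_mul_choose_succ_cast n j
      push_cast
      rw [show (m : ℝ) + 1 + n - (j + 1) = m + n - j by ring, pow_succ]
      linear_combination (-((m : ℝ) + 1) / ((m : ℝ) + n - j)) * ((-1 : ℝ) ^ j *
        (bernoulliFun j z * bernoulliFun (m + n - j) (y + z))) * this
    rw [h2]
    simp only [Nat.cast_zero, zero_mul, mul_zero, add_zero]
    rw [← Finset.sum_add_distrib, mul_add, Finset.mul_sum]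
    -- For `m = 0` the ratio `(n-j)/(m+n-j)` at `j = n` is `0/0`, read as `0`. The term `(-1)^n
    -- Bₙ(z)` is therefore left over; it later cancels against the derivative of the last term of
    -- the defect.
    by_cases hm : m = 0
    · subst hm
      rw [Finset.sum_range_succ, Finset.sum_range_succ (n := n)]
      have h3 : ∀ j ∈ Finset.range n, (n : ℝ) - j ≠ 0 := fun j hj => by
        have := Finset.mem_range.mp hj
        exact sub_ne_zero.mpr (by exact_mod_cast this.ne')
      rw [Finset.sum_congr rfl (g := fun j => ((0 : ℕ) + 1 : ℝ) * ((n.choose j : ℝ) *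
        (((0 : ℕ) : ℝ) / (((0 : ℕ) : ℝ) + n - j)) *
        ((-1) ^ j * (bernoulliFun j z * bernoulliFun (0 + n - j) (y + z)))))]
      · simp
      · intro j hj
        have := h3 j hj
        simp [this]
    · simp only [hm, if_false, mul_zero, add_zero]
      refine Finset.sum_congr rfl fun j hj => ?_
      have hj' : j ≤ n := Nat.lt_succ_iff.mp (Finset.mem_range.mp hj)
      have h0 : (m : ℝ) + n - j ≠ 0 := by
        have : (j : ℝ) ≤ n := by exact_mod_cast hj'
        have : (0 : ℝ) < m := by exact_mod_cast Nat.pos_of_ne_zero hm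
        linarith
      field_simp
      ring
  have s4 : (-1 : ℝ) ^ n * (((m + 1).factorial : ℝ) * n.factorial / (m + 1 + n).factorial) *
      (((m + 1 + n : ℕ) : ℝ) * bernoulliFun (m + 1 + n - 1) z) =
      (m + 1) * ((-1) ^ n * ((m.factorial : ℝ) * n.factorial / (m + n).factorial) *
        bernoulliFun (m + n) z) := by
    rw [show m + 1 + n = m + n + 1 by ring, Nat.add_sub_cancel, Nat.factorial_succ,
      Nat.factorial_succ (m + n)]
    have := Nat.factorial_ne_zero (m + n)
    push_cast
    field_simp
  rw [s2, s3, s4, Nat.add_sub_cancel]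
  split_ifs with hm
  · subst hm
    simp
    have : (n.factorial : ℝ) ≠ 0 := by positivity
    have : (n : ℝ) ≠ 0 := by positivity
    field_simp
    ring
  · rw [bernoulliProductDefect]
    push_cast
    ring

/-- Between `z = 0` and `z = 1` only `B₁(z)` changes, and `y` moves to `y + 1`. The forward
differences cancel, the one from the second sum being evaluated by
`sum_choose_neg_one_pow_mul_bernoulliFun_zero`. -/
theorem bernoulliProductDefect_one_eq_zero {m n : ℕ} (hm : 1 ≤ m) (hn : 1 ≤ n) (y : ℝ) :
    bernoulliProductDefect (m + 1) n y 1 = bernoulliProductDefect (m + 1) n y 0 := by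
  have h1 : ∀ k, bernoulliFun k 1 = bernoulliFun k 0 + ite (k = 1) 1 0 := bernoulliFun_eval_one
  have s2 : ∑ j ∈ Finset.range (m + 1 + 1),
      ((m + 1).choose j : ℝ) * ((n : ℝ) / (((m + 1 : ℕ) : ℝ) + n - j)) *
        (bernoulliFun j 1 * bernoulliFun (m + 1 + n - j) y) =
      ∑ j ∈ Finset.range (m + 1 + 1),
      ((m + 1).choose j : ℝ) * ((n : ℝ) / (((m + 1 : ℕ) : ℝ) + n - j)) *
        (bernoulliFun j 0 * bernoulliFun (m + 1 + n - j) y) +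
      (m + 1) * (n / (m + n)) * bernoulliFun (m + n) y := by
    simp only [h1, add_mul, mul_add, Finset.sum_add_distrib]
    congr 1
    rw [Finset.sum_eq_single 1]
    · simp only [Nat.choose_one_right, if_true, one_mul, Nat.cast_add, Nat.cast_one]
      rw [show m + 1 + n - 1 = m + n by omega]
      ring_nf
    · intro j _ hj; simp [hj]
    · intro h; simp at h
  have s3 : ∑ j ∈ Finset.range (n + 1), (n.choose j : ℝ) *
      (((m + 1 : ℕ) : ℝ) / (((m + 1 : ℕ) : ℝ) + n - j)) *
      ((-1) ^ j * (bernoulliFun j 1 * bernoulliFun (m + 1 + n - j) (y + 1))) =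
      ∑ j ∈ Finset.range (n + 1), (n.choose j : ℝ) *
      (((m + 1 : ℕ) : ℝ) / (((m + 1 : ℕ) : ℝ) + n - j)) *
      ((-1) ^ j * (bernoulliFun j 0 * bernoulliFun (m + 1 + n - j) y)) +
      (m + 1) * y ^ m * (bernoulliFun n y + n * y ^ (n - 1)) -
      (m + 1) * (n / (m + n)) * bernoulliFun (m + n) (y + 1) := by
    rw [Finset.sum_congr rfl fun j _ => show _ = (n.choose j : ℝ) *
      (((m + 1 : ℕ) : ℝ) / (((m + 1 : ℕ) : ℝ) + n - j)) *
      ((-1) ^ j * (bernoulliFun j 0 * bernoulliFun (m + 1 + n - j) (y + 1))) +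
      (n.choose j : ℝ) * (((m + 1 : ℕ) : ℝ) / (((m + 1 : ℕ) : ℝ) + n - j)) *
      ((-1) ^ j * ((if j = 1 then 1 else 0) * bernoulliFun (m + 1 + n - j) (y + 1))) by
        rw [h1]; ring, Finset.sum_add_distrib]
    rw [← sum_choose_neg_one_pow_mul_bernoulliFun_zero, sub_eq_add_neg]
    congr 1
    · rw [Finset.mul_sum, ← Finset.sum_add_distrib]
      refine Finset.sum_congr rfl fun j hj => ?_
      have hj' : j ≤ n := Nat.lt_succ_iff.mp (Finset.mem_range.mp hj)
      have hc : ((m + 1 + n - j : ℕ) : ℝ) = (m : ℝ) + 1 + n - j := by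
        push_cast [show j ≤ m + 1 + n by omega]; ring
      have h0 : (m : ℝ) + 1 + n - j ≠ 0 := by
        rw [← hc]; exact_mod_cast (by omega : m + 1 + n - j ≠ 0)
      rw [bernoulliFun_add_one, hc, show m + 1 + n - j - 1 = m + (n - j) by omega, pow_add]
      push_cast
      field_simp
    · rw [Finset.sum_eq_single 1]
      · simp only [Nat.choose_one_right, if_true, one_mul, Nat.cast_add, Nat.cast_one]
        rw [show m + 1 + n - 1 = m + n by omega, show (m : ℝ) + 1 + n - 1 = m + n by ring]
        ring
      · intro j _ hj; simp [hj]
      · intro h; simp at h; omega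
  rw [bernoulliProductDefect, bernoulliProductDefect, s2, s3, bernoulliFun_add_one (m + 1),
    bernoulliFun_add_one (m + n), h1 (m + 1 + n), if_neg (by omega)]
  simp only [add_zero, Nat.add_sub_cancel]
  have h0 : (m : ℝ) + n ≠ 0 := by positivity
  rw [show m + n - 1 = m + (n - 1) by omega, pow_add]
  push_cast
  field_simp
  ring_nf

/-- If the defect of index `m` is a constant `C` in `z`, that of index `m + 1` is affine in `z` with
slope `(m+1)C`. Equal values at `0` and `1` force `C = 0`. This makes an induction on `m` possible:
each vanishing defect makes the next one constant. -/
theorem bernoulliProductDefect_eq_zero_of_const {m n : ℕ} (hm : 1 ≤ m) (hn : 1 ≤ n) (y : ℝ)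
    (h : ∀ z, bernoulliProductDefect m n y z = bernoulliProductDefect m n y 0) (z : ℝ) :
    bernoulliProductDefect m n y z = 0 := by
  have hd : ∀ w, HasDerivAt (fun w => bernoulliProductDefect (m + 1) n y w -
      (m + 1) * bernoulliProductDefect m n y 0 * w) 0 w := fun w => by
    have := (hasDerivAt_bernoulliProductDefect m hn y w).sub
      ((hasDerivAt_id w).const_mul ((m + 1) * bernoulliProductDefect m n y 0))
    rw [if_neg (by omega), h w, mul_one, sub_self] at this
    simpa using! this
  have h1 := is_const_of_deriv_eq_zero (fun w => (hd w).differentiableAt)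
    (fun w => (hd w).deriv) 1 0
  simp only [bernoulliProductDefect_one_eq_zero hm hn y, mul_one, mul_zero, sub_zero,
    sub_eq_self] at h1
  rw [h z]
  exact (mul_eq_zero.mp h1).resolve_left (by positivity)

theorem bernoulliProductDefect_eq_zero {m n : ℕ} (hm : 1 ≤ m) (hn : 1 ≤ n) (y z : ℝ) :
    bernoulliProductDefect m n y z = 0 := by
  induction m, hm using Nat.le_induction generalizing z with
  | base =>
    exact bernoulliProductDefect_eq_zero_of_const le_rfl hn y (fun w => is_const_of_deriv_eq_zero
      (fun x => (hasDerivAt_bernoulliProductDefect 0 hn y x).differentiableAt)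
      (fun x => by simpa using (hasDerivAt_bernoulliProductDefect 0 hn y x).deriv) w 0) z
  | succ m hm ih =>
    exact bernoulliProductDefect_eq_zero_of_const (by omega) hn y
      (fun w => is_const_of_deriv_eq_zero
      (fun x => (hasDerivAt_bernoulliProductDefect m hn y x).differentiableAt)
      (fun x => by simpa [ih] using (hasDerivAt_bernoulliProductDefect m hn y x).deriv) w 0) z

theorem bernoulliBar_add_int (n : ℕ) (x : ℝ) (k : ℤ) :
    bernoulliBar n (x + k) = bernoulliBar n x := by
  simp [bernoulliBar]

theorem bernoulliBar_fract (n : ℕ) (x : ℝ) : bernoulliBar n (Int.fract x) = bernoulliBar n x := by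
  simp [bernoulliBar]

theorem bernoulliBar_eq_add_ite {n : ℕ} {x : ℝ} (h0 : 0 ≤ x) (h1 : x < 1) :
    bernoulliBar n x = bernoulliFun n x + if n = 1 then (if x = 0 then 1 / 2 else 0) else 0 := by
  rw [bernoulliBar, Int.fract_eq_self.mpr ⟨h0, h1⟩]
  by_cases hn : n = 1 <;> by_cases hx : x = 0 <;> simp [hn, hx]

theorem bernoulliBar_of_ne_one {n : ℕ} (hn : n ≠ 1) (x : ℝ) :
    bernoulliBar n x = bernoulliFun n (Int.fract x) := by
  simp [bernoulliBar, hn]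

theorem bernoulliBar_zero_left (x : ℝ) : bernoulliBar 0 x = 1 := by
  simp [bernoulliBar]

theorem neg_one_pow_mul_bernoulliFun_zero {n : ℕ} (hn : n ≠ 1) :
    (-1) ^ n * bernoulliFun n 0 = bernoulliFun n 0 := by
  rw [← bernoulliFun_eval_one_sub, sub_zero, bernoulliFun_endpoints_eq_of_ne_one hn]

theorem bernoulliBar_neg (n : ℕ) (x : ℝ) :
    bernoulliBar n (-x) = (-1) ^ n * bernoulliBar n x := by
  by_cases hx : Int.fract x = 0
  · have hx' : Int.fract (-x) = 0 := Int.fract_neg_eq_zero.mpr hx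
    by_cases hn : n = 1
    · simp [bernoulliBar, hn, hx, hx']
    · rw [bernoulliBar_of_ne_one hn, bernoulliBar_of_ne_one hn, hx, hx',
        neg_one_pow_mul_bernoulliFun_zero hn]
  · have hx' : Int.fract (-x) ≠ 0 := fun h => hx (Int.fract_neg_eq_zero.mp h)
    rw [bernoulliBar, bernoulliBar, if_neg (by tauto), if_neg (by tauto), Int.fract_neg hx,
      bernoulliFun_eval_one_sub]

theorem bernoulliBar_sub_comm (n : ℕ) (x y : ℝ) :
    bernoulliBar n (y - x) = (-1) ^ n * bernoulliBar n (x - y) := by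
  rw [← bernoulliBar_neg, neg_sub]

theorem deltaInt_add_int (x : ℝ) (k : ℤ) : deltaInt (x + k) = deltaInt x := by
  unfold deltaInt
  congr 1
  refine propext ⟨fun ⟨j, hj⟩ => ⟨j - k, by push_cast; linarith⟩,
    fun ⟨j, hj⟩ => ⟨j + k, by push_cast; linarith⟩⟩

theorem deltaInt_fract (x : ℝ) : deltaInt x = if Int.fract x = 0 then 1 else 0 := by
  unfold deltaInt
  congr 1
  exact propext (by simp [Int.fract_eq_zero_iff])

/-- Bookkeeping for the passage from `Bₙ` to `B̄ₙ`, which alters only index `1`: `p` and `e` are the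
alterations of the two factors. The second factor has index `1` only when `j = m` and `n = 1`. -/
theorem sum_choose_mul_add_ite {m n : ℕ} (hm : 1 ≤ m) (hn : 1 ≤ n) (f g : ℕ → ℝ) (p e : ℝ) :
    ∑ j ∈ Finset.range (m + 1), (m.choose j : ℝ) * ((n : ℝ) / ((m : ℝ) + n - j)) *
      ((f j + if j = 1 then p else 0) * (g (m + n - j) + if m + n - j = 1 then e else 0)) =
    ∑ j ∈ Finset.range (m + 1), (m.choose j : ℝ) * ((n : ℝ) / ((m : ℝ) + n - j)) *
      (f j * g (m + n - j)) + p * (m * n / ((m : ℝ) + n - 1)) * g (m + n - 1) +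
      (if n = 1 then e * f m else 0) + if m = 1 ∧ n = 1 then p * e else 0 := by
  have hsplit : ∀ j ∈ Finset.range (m + 1),
      (m.choose j : ℝ) * ((n : ℝ) / ((m : ℝ) + n - j)) *
      ((f j + if j = 1 then p else 0) * (g (m + n - j) + if m + n - j = 1 then e else 0)) =
      (m.choose j : ℝ) * ((n : ℝ) / ((m : ℝ) + n - j)) * (f j * g (m + n - j)) +
      (if j = 1 then (m.choose j : ℝ) * ((n : ℝ) / ((m : ℝ) + n - j)) * p * g (m + n - j) else 0) +
      (if j = m then (if n = 1 then (m.choose j : ℝ) * ((n : ℝ) / ((m : ℝ) + n - j)) * e *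
        (f j + if j = 1 then p else 0) else 0) else 0) := by
    intro j hj
    have hj' := Finset.mem_range.mp hj
    have : m + n - j = 1 ↔ j = m ∧ n = 1 := by omega
    rw [if_congr this rfl rfl, ite_and]
    split_ifs <;> ring
  rw [Finset.sum_congr rfl hsplit, Finset.sum_add_distrib, Finset.sum_add_distrib,
    Finset.sum_ite_eq', Finset.sum_ite_eq', if_pos (by simp; omega), if_pos (by simp)]
  rw [add_assoc, add_assoc, add_assoc]
  congr 1
  by_cases hn1 : n = 1
  · subst hn1
    by_cases hm1 : m = 1
    · subst hm1; norm_num; ring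
    · have : (m : ℝ) ≠ 0 := by positivity
      have h1 : (m : ℝ) + 1 - 1 = m := by ring
      simp only [hm1, Nat.choose_one_right, Nat.choose_self, Nat.cast_one, if_true, if_false,
        false_and, h1, Nat.add_sub_cancel, add_sub_cancel_left]
      field_simp
      ring
  · simp only [hn1, Nat.choose_one_right, Nat.cast_one, if_false, and_false]
    ring

/-- The polynomial identity at `z = x - y`, corrected by `1/2` wherever `B̄₁` is evaluated at `0`.
The delta term accounts for the product of two such corrections. -/
theorem bernoulliBar_mul_of_le {m n : ℕ} (hm : 1 ≤ m) (hn : 1 ≤ n) {x y : ℝ}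
    (hy : 0 ≤ y) (hyx : y ≤ x) (hx : x < 1) :
    bernoulliBar m x * bernoulliBar n y =
      ∑ j ∈ Finset.range (m + 1), (m.choose j : ℝ) * ((n : ℝ) / ((m : ℝ) + n - j)) *
        (bernoulliBar j (x - y) * bernoulliBar (m + n - j) y) +
      ∑ j ∈ Finset.range (n + 1), (n.choose j : ℝ) * ((m : ℝ) / ((n : ℝ) + m - j)) *
        (bernoulliBar j (y - x) * bernoulliBar (n + m - j) x) -
      (-1) ^ n * ((m.factorial : ℝ) * n.factorial / (m + n).factorial) *
        bernoulliBar (m + n) (x - y) -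
      if m = 1 ∧ n = 1 then deltaInt x * deltaInt y / 4 else 0 := by
  have hG := bernoulliProductDefect_eq_zero hm hn y (x - y)
  rw [bernoulliProductDefect, add_sub_cancel] at hG
  have hz : ∀ j, bernoulliBar j (x - y) = _ := fun j =>
    bernoulliBar_eq_add_ite (n := j) (sub_nonneg.mpr hyx) (by linarith)
  have hz' : ∀ j, bernoulliBar j (y - x) = (-1) ^ j * bernoulliFun j (x - y) +
      if j = 1 then -(if x - y = 0 then 1 / 2 else 0) else 0 := fun j => by
    rw [bernoulliBar_sub_comm, hz]; split_ifs with h <;> simp [h]; ring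
  have hX : ∀ j, bernoulliBar j x = _ := fun j =>
    bernoulliBar_eq_add_ite (n := j) (hy.trans hyx) hx
  have hY : ∀ j, bernoulliBar j y = _ := fun j =>
    bernoulliBar_eq_add_ite (n := j) hy (hyx.trans_lt hx)
  have hx' : Int.fract x = x := Int.fract_eq_self.mpr ⟨hy.trans hyx, hx⟩
  have hy' : Int.fract y = y := Int.fract_eq_self.mpr ⟨hy, hyx.trans_lt hx⟩
  rw [deltaInt_fract, deltaInt_fract, hx', hy', hz (m + n), if_neg (by omega)]
  simp only [hz, hz', hX, hY]
  rw [sum_choose_mul_add_ite hm hn (fun j => bernoulliFun j (x - y)) (fun j => bernoulliFun j y),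
    sum_choose_mul_add_ite hn hm (fun j => (-1) ^ j * bernoulliFun j (x - y))
      (fun j => bernoulliFun j x)]
  simp only [add_comm (n : ℝ) m, add_comm n m, mul_comm (n : ℝ) m]
  simp only [mul_assoc] at hG ⊢
  -- For `x = y` the corrections of `B̄₁(x-y)` and `B̄₁(y-x)` have opposite signs. For `y < x` only
  -- `y` can be `0`, and when `n = 1` its correction adds `Bₘ(x)/2` to both sides.
  rcases eq_or_lt_of_le hyx with rfl | hlt
  · have hb := fun k => neg_one_pow_mul_bernoulliFun_zero (n := k)
    simp only [sub_self, if_true] at hG ⊢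
    by_cases h3 : y = 0
    · subst h3
      by_cases hm1 : m = 1
      · by_cases hn1 : n = 1
        · subst hm1 hn1
          simp at hG ⊢; linarith
        · have := hb n hn1
          simp [hm1, hn1] at hG ⊢; linarith
      · by_cases hn1 : n = 1
        · simp [hm1, hn1] at hG ⊢; linarith
        · simp [hm1, hn1] at hG ⊢; linarith
    · simp [h3] at hG ⊢; linarith
  · have h1 : x - y ≠ 0 := (sub_pos.mpr hlt).ne'
    have h2 : x ≠ 0 := (hy.trans_lt hlt).ne'
    simp only [h1, h2, if_false]
    by_cases h3 : y = 0
    · subst h3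
      simp only [sub_zero] at hG ⊢
      by_cases hn1 : n = 1
      · simp [hn1] at hG ⊢; linarith
      · simp [hn1] at hG ⊢; linarith
    · simp [h3] at hG ⊢; linarith

theorem bernoulliBar_mul {m n : ℕ} (hm : 1 ≤ m) (hn : 1 ≤ n) (x y : ℝ) :
    bernoulliBar m x * bernoulliBar n y =
      ∑ j ∈ Finset.range (m + 1), (m.choose j : ℝ) * ((n : ℝ) / ((m : ℝ) + n - j)) *
        (bernoulliBar j (x - y) * bernoulliBar (m + n - j) y) +
      ∑ j ∈ Finset.range (n + 1), (n.choose j : ℝ) * ((m : ℝ) / ((n : ℝ) + m - j)) *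
        (bernoulliBar j (y - x) * bernoulliBar (n + m - j) x) -
      (-1) ^ n * ((m.factorial : ℝ) * n.factorial / (m + n).factorial) *
        bernoulliBar (m + n) (x - y) -
      if m = 1 ∧ n = 1 then deltaInt x * deltaInt y / 4 else 0 := by
  wlog h : Int.fract y ≤ Int.fract x generalizing m n x y
  · have := this hn hm y x (le_of_not_ge h)
    rw [mul_comm, this, bernoulliBar_sub_comm (n + m) x y, add_comm n m]
    simp only [and_comm (a := n = 1), mul_comm (deltaInt y)]
    have hs : ((-1 : ℝ) ^ m) * (-1) ^ m = 1 := by rw [← mul_pow]; simp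
    rw [pow_add]
    linear_combination (-(-1) ^ n * ((m.factorial : ℝ) * n.factorial / (m + n).factorial) *
        bernoulliBar (m + n) (x - y)) * hs
  · have key := bernoulliBar_mul_of_le hm hn (Int.fract_nonneg y) h (Int.fract_lt_one x)
    have e1 : ∀ j, bernoulliBar j (Int.fract x - Int.fract y) = bernoulliBar j (x - y) := fun j => by
      rw [← bernoulliBar_add_int j _ (⌊x⌋ - ⌊y⌋)]
      congr 1; simp only [Int.fract]; push_cast; ring
    have e2 : ∀ j, bernoulliBar j (Int.fract y - Int.fract x) = bernoulliBar j (y - x) := fun j => by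
      rw [← bernoulliBar_add_int j _ (⌊y⌋ - ⌊x⌋)]
      congr 1; simp only [Int.fract]; push_cast; ring
    simpa only [bernoulliBar_fract, e1, e2, deltaInt_fract, Int.fract_fract] using key

/-! ### Sums over residues and the distribution relation for Bernoulli functions. -/

theorem Function.Periodic.apply_zmod_val {α : Type*} {N : ℕ} [NeZero N] {f : ℤ → α}
    (hf : Function.Periodic f N) (k : ℤ) : f ((k : ZMod N).val) = f k := by
  rw [ZMod.val_intCast, Int.emod_def, mul_comm]
  simpa using hf.sub_int_mul_eq (x := k) (k / N)

section PeriodicSums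

variable {M : Type*} [AddCommMonoid M]

theorem sum_zmod_val_eq_sum_range (N : ℕ) [NeZero N] (f : ℕ → M) :
    ∑ x : ZMod N, f x.val = ∑ i ∈ Finset.range N, f i := by
  obtain ⟨k, rfl⟩ := Nat.exists_eq_succ_of_ne_zero (NeZero.ne N)
  exact Fin.sum_univ_eq_sum_range f (k + 1)

theorem Function.Periodic.sum_range_comp_affine {N : ℕ} (hN : N ≠ 0) {f : ℤ → M}
    (hf : Function.Periodic f N) {a : ℕ} (ha : a.Coprime N) (k : ℤ) :
    ∑ i ∈ Finset.range N, f (k + a * i) = ∑ i ∈ Finset.range N, f i := by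
  have : NeZero N := ⟨hN⟩
  rw [← sum_zmod_val_eq_sum_range N fun i => f (k + a * i),
    ← sum_zmod_val_eq_sum_range N fun i => f i]
  let u := ZMod.unitOfCoprime a ha
  refine Fintype.sum_equiv ((Units.mulLeft u).trans (Equiv.addLeft (k : ZMod N))) _ _ fun x => ?_
  rw [← hf.apply_zmod_val]
  simp [u]

theorem Function.Periodic.sum_range_add_mul_div {F : ℝ → M} (hF : Function.Periodic F 1) {N : ℕ}
    (hN : N ≠ 0) {a : ℕ} (ha : a.Coprime N) (x : ℝ) (k : ℤ) :
    ∑ i ∈ Finset.range N, F (x + (k + a * i) / N) = ∑ i ∈ Finset.range N, F (x + i / N) := by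
  have hf : Function.Periodic (fun i : ℤ => F (x + i / N)) N := fun i => by
    have : (N : ℝ) ≠ 0 := by exact_mod_cast hN
    show F (x + ((i + (N : ℤ) : ℤ) : ℝ) / N) = F (x + i / N)
    rw [← hF (x + i / N)]; congr 1; push_cast; field_simp; ring
  simpa using hf.sum_range_comp_affine hN ha k

theorem Finset.sum_range_mul_comm_div (g b : ℕ) (f : ℕ → M) :
    ∑ i ∈ Finset.range (g * b), f i = ∑ k ∈ Finset.range g, ∑ i ∈ Finset.range b, f (k * b + i) := by
  induction g with
  | zero => simp
  | succ g ih => rw [Nat.succ_mul, Finset.sum_range_add, ih, Finset.sum_range_succ]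

theorem Function.Periodic.sum_Icc_eq_sum_range {F : ℝ → M} (hF : Function.Periodic F 1) {N : ℕ}
    (hN : N ≠ 0) :
    ∑ i ∈ Finset.Icc 1 N, F ((i : ℝ) / N) = ∑ i ∈ Finset.range N, F ((i : ℝ) / N) := by
  have : (N : ℝ) ≠ 0 := by exact_mod_cast hN
  rw [Finset.range_eq_Ico, Finset.sum_eq_sum_Ico_succ_bot (by omega),
    ← Finset.Ico_add_one_right_eq_Icc, Finset.sum_Ico_succ_top (by omega), add_comm]
  congr 1
  simpa [div_self this] using hF 0

end PeriodicSums

theorem bernoulliBar_periodic (n : ℕ) : Function.Periodic (bernoulliBar n) 1 := fun x => by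
  simpa using bernoulliBar_add_int n x 1

/-- Raabe's formula. By periodicity `x` may be replaced by `t/N` with `t` the fractional part of
`Nx`; all the points then lie in `[0, 1)`, and the value `B̄₁(0)` occurs only for `i = 0`, `t = 0`.
-/
theorem sum_bernoulliBar_add_div (n : ℕ) {N : ℕ} (hN : N ≠ 0) (x : ℝ) :
    ∑ i ∈ Finset.range N, bernoulliBar n (x + i / N) = N / N ^ n * bernoulliBar n (N * x) := by
  have hN' : (0 : ℝ) < N := by exact_mod_cast Nat.pos_of_ne_zero hN
  set t := Int.fract (N * x) with ht
  have ht0 : 0 ≤ t := Int.fract_nonneg _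
  have ht1 : t < 1 := Int.fract_lt_one _
  have h1 : ∑ i ∈ Finset.range N, bernoulliBar n (x + i / N) =
      ∑ i ∈ Finset.range N, bernoulliBar n (t / N + i / N) := by
    rw [← (bernoulliBar_periodic n).sum_range_add_mul_div hN (Nat.coprime_one_left N) (t / N)
      ⌊N * x⌋]
    refine Finset.sum_congr rfl fun i _ => ?_
    congr 1
    rw [ht, Int.fract]; push_cast; field_simp; ring
  have h2 : ∀ i ∈ Finset.range N, bernoulliBar n (t / N + i / N) =
      bernoulliFun n (t / N + i / N) +
        if i = 0 then (if n = 1 then (if t = 0 then 1 / 2 else 0) else 0) else 0 := by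
    intro i hi
    have hi' : ((i : ℝ) + 1) ≤ N := by exact_mod_cast Finset.mem_range.mp hi
    rw [bernoulliBar_eq_add_ite (by positivity)
      (by rw [← add_div, div_lt_one hN']; linarith)]
    have : t / N + i / N = 0 ↔ i = 0 ∧ t = 0 := by
      rw [← add_div, div_eq_zero_iff, or_iff_left hN'.ne', add_eq_zero_iff_of_nonneg ht0 (by positivity)]
      simp [and_comm]
    rw [if_congr this rfl rfl, ite_and]
    split_ifs <;> rfl
  have h3 := bernoulliFun_mul n hN (t / N)
  rw [mul_div_cancel₀ _ hN'.ne'] at h3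
  rw [h1, Finset.sum_congr rfl h2, Finset.sum_add_distrib, Finset.sum_ite_eq',
    if_pos (Finset.mem_range.mpr (Nat.pos_of_ne_zero hN)), ← bernoulliBar_fract n (N * x), ← ht,
    bernoulliBar_eq_add_ite ht0 ht1, h3]
  split_ifs with h4 h5 <;> [subst h4; skip; skip] <;> field_simp <;> ring

theorem sum_bernoulliBar_add_mul_div_of_coprime (n : ℕ) {N : ℕ} (hN : N ≠ 0) {a : ℕ}
    (ha : a.Coprime N) (x : ℝ) :
    ∑ i ∈ Finset.range N, bernoulliBar n (x + a * i / N) = N / N ^ n * bernoulliBar n (N * x) := by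
  rw [← sum_bernoulliBar_add_div n hN,
    ← (bernoulliBar_periodic n).sum_range_add_mul_div hN ha x 0]
  simp

/-- With `g = gcd(a, b)`, the sum runs `g` times through a complete residue system modulo `b/g`. -/
theorem sum_bernoulliBar_add_mul_div (n a : ℕ) {b : ℕ} (hb : b ≠ 0) (x : ℝ) :
    ∑ i ∈ Finset.range b, bernoulliBar n (x + a * i / b) =
      a.gcd b * ((b / a.gcd b : ℕ) / (b / a.gcd b : ℕ) ^ n *
        bernoulliBar n ((b / a.gcd b : ℕ) * x)) := by
  have hg : a.gcd b ≠ 0 := Nat.gcd_ne_zero_right hb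
  obtain ⟨a', b', hco, ha, hb'⟩ := Nat.exists_coprime a b
  set g := a.gcd b
  have hgR : (g : ℝ) ≠ 0 := by exact_mod_cast hg
  have hb0 : b' ≠ 0 := by rintro rfl; simp at hb'; exact hb hb'
  have hb0R : (b' : ℝ) ≠ 0 := by exact_mod_cast hb0
  have hdiv : b / g = b' := by rw [hb', Nat.mul_div_cancel _ (Nat.pos_of_ne_zero hg)]
  rw [hdiv, ← sum_bernoulliBar_add_mul_div_of_coprime n hb0 hco x]
  rw [show Finset.range b = Finset.range (g * b') by rw [hb', mul_comm],
    Finset.sum_range_mul_comm_div, Finset.sum_congr rfl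
      (g := fun _ => ∑ i ∈ Finset.range b', bernoulliBar n (x + a' * i / b')),
    Finset.sum_const, Finset.card_range, nsmul_eq_mul]
  intro k _
  refine Finset.sum_congr rfl fun i _ => ?_
  rw [← bernoulliBar_add_int n (x + a' * i / b') (k * a')]
  congr 1
  have h1 : (a : ℝ) = a' * g := by exact_mod_cast ha
  have h2 : (b : ℝ) = b' * g := by exact_mod_cast hb'
  rw [h1, h2]; push_cast; field_simp
  ring

/-! ### Dedekind–Rademacher reciprocity. -/

/-- One of the two finite sums in the reciprocity law for Dedekind–Rademacher sums. -/
noncomputable def reciprocitySum (m n a b d : ℕ) (w v : ℝ) : ℝ :=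
  n * (b : ℝ) ^ (n - 1) * ∑ j ∈ Finset.range (m + 1),
    (m.choose j : ℝ) * ((-1) ^ j * (a : ℝ) ^ (m - j) / ((m : ℝ) + n - j)) *
      ∑ k ∈ Finset.range b, bernoulliBar j (a * (w + k / b)) *
        ((d : ℝ) ^ j * bernoulliBar (m + n - j) (d * (v + k / b)))

/-- The shift `s/d` drops out of the difference of the arguments, so `h` occurs only in the first
factor and `s` only in the second. Raabe's formula evaluates both sums, leaving the sum over `k`. -/
theorem sum_reciprocity_part {m n : ℕ} (hn : 1 ≤ n) {a b d : ℕ} (ha : a ≠ 0)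
    (hb : b ≠ 0) (hd : d ≠ 0) (u v : ℝ) :
    (d : ℝ) ^ (m + n - 1) * ((a : ℝ) ^ m / a * ((b : ℝ) ^ n / b)) *
      ∑ s ∈ Finset.range d, ∑ h ∈ Finset.range a, ∑ k ∈ Finset.range b,
        ∑ j ∈ Finset.range (m + 1), (m.choose j : ℝ) * ((n : ℝ) / ((m : ℝ) + n - j)) *
        (bernoulliBar j ((s / d + u + h / a) - (s / d + v + k / b)) *
          bernoulliBar (m + n - j) (s / d + v + k / b)) =
      reciprocitySum m n a b d (v - u) v := by
  have ha' : (a : ℝ) ≠ 0 := by exact_mod_cast ha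
  have hb' : (b : ℝ) ≠ 0 := by exact_mod_cast hb
  have hd' : (d : ℝ) ≠ 0 := by exact_mod_cast hd
  have h1 : ∑ s ∈ Finset.range d, ∑ h ∈ Finset.range a, ∑ k ∈ Finset.range b,
        ∑ j ∈ Finset.range (m + 1), (m.choose j : ℝ) * ((n : ℝ) / ((m : ℝ) + n - j)) *
        (bernoulliBar j ((s / d + u + h / a) - (s / d + v + k / b)) *
          bernoulliBar (m + n - j) (s / d + v + k / b)) =
      ∑ j ∈ Finset.range (m + 1), (m.choose j : ℝ) * ((n : ℝ) / ((m : ℝ) + n - j)) *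
        ∑ k ∈ Finset.range b,
          (∑ h ∈ Finset.range a, bernoulliBar j ((u - v - k / b) + h / a)) *
          ∑ s ∈ Finset.range d, bernoulliBar (m + n - j) ((v + k / b) + s / d) := by
    simp only [Finset.mul_sum, Finset.sum_mul]
    rw [Finset.sum_congr rfl fun s _ => Finset.sum_congr rfl fun h _ => Finset.sum_comm]
    rw [Finset.sum_congr rfl fun s _ => Finset.sum_comm]
    rw [Finset.sum_comm]
    refine Finset.sum_congr rfl fun j _ => ?_
    rw [Finset.sum_congr rfl fun s _ => Finset.sum_comm]
    rw [Finset.sum_comm]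
    refine Finset.sum_congr rfl fun k _ => ?_
    refine Finset.sum_congr rfl fun s _ => Finset.sum_congr rfl fun h _ => ?_
    congr 3 <;> ring
  rw [h1, reciprocitySum, Finset.mul_sum, Finset.mul_sum]
  refine Finset.sum_congr rfl fun j hj => ?_
  have hj' : j ≤ m := Nat.lt_succ_iff.mp (Finset.mem_range.mp hj)
  obtain ⟨i, rfl⟩ := Nat.exists_eq_add_of_le hj'
  obtain ⟨n, rfl⟩ := Nat.exists_eq_add_of_le' hn
  have h0 : ((j + i : ℕ) : ℝ) + (n + 1 : ℕ) - j ≠ 0 := by push_cast; ring_nf; positivity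
  simp only [sum_bernoulliBar_add_div _ ha, sum_bernoulliBar_add_div _ hd, Finset.mul_sum]
  refine Finset.sum_congr rfl fun k _ => ?_
  rw [show (a : ℝ) * (u - v - k / b) = -(a * (v - u + k / b)) by ring, bernoulliBar_neg,
    show j + i + (n + 1) - 1 = j + (i + n) by omega,
    show j + i + (n + 1) - j = i + n + 1 by omega, Nat.add_sub_cancel_left, Nat.add_sub_cancel]
  generalize ((j + i : ℕ) : ℝ) + (n + 1 : ℕ) - j = D at h0 ⊢
  rw [pow_add, pow_add, pow_succ, pow_succ]
  field_simp
  ring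

theorem sum_sum_bernoulliBar_sub {n a b : ℕ} (ha : a ≠ 0) (hb : b ≠ 0) (x : ℝ) :
    ∑ h ∈ Finset.range a, ∑ k ∈ Finset.range b, bernoulliBar n (h / a - (x + k / b)) =
      (-1) ^ n * (a * b * (a.gcd b : ℝ) ^ n / ((a : ℝ) ^ n * (b : ℝ) ^ n)) *
        bernoulliBar n ((a * b / a.gcd b : ℕ) * x) := by
  have ha' : (a : ℝ) ≠ 0 := by exact_mod_cast ha
  have hb' : (b : ℝ) ≠ 0 := by exact_mod_cast hb
  have hg : a.gcd b ≠ 0 := Nat.gcd_ne_zero_right hb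
  have hg' : (a.gcd b : ℝ) ≠ 0 := by exact_mod_cast hg
  have hdiv : ((b / a.gcd b : ℕ) : ℝ) = b / a.gcd b := Nat.cast_div (Nat.gcd_dvd_right a b) hg'
  have hdiv' : ((a * b / a.gcd b : ℕ) : ℝ) = a * b / a.gcd b := by
    rw [Nat.cast_div ((Nat.gcd_dvd_right a b).mul_left a) hg', Nat.cast_mul]
  have h1 : ∀ k ∈ Finset.range b, ∑ h ∈ Finset.range a, bernoulliBar n (h / a - (x + k / b)) =
      (-1) ^ n * (a / (a : ℝ) ^ n) * bernoulliBar n (a * x + a * k / b) := fun k _ => by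
    rw [Finset.sum_congr rfl fun h _ => by rw [sub_eq_neg_add], sum_bernoulliBar_add_div _ ha,
      mul_neg, bernoulliBar_neg, show (a : ℝ) * (x + k / b) = a * x + a * k / b by ring]
    ring
  rw [Finset.sum_comm, Finset.sum_congr rfl h1, ← Finset.mul_sum,
    sum_bernoulliBar_add_mul_div n a hb, hdiv, hdiv',
    show (b : ℝ) / a.gcd b * (a * x) = a * b / a.gcd b * x by ring, div_pow]
  field_simp

/-- **Reciprocity law** for the Dedekind–Rademacher sums built from Bernoulli functions. -/
theorem dedekind_rademacher_reciprocity {m n : ℕ} (hm : 1 ≤ m) (hn : 1 ≤ n) {a b d : ℕ}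
    (ha : a ≠ 0) (hb : b ≠ 0) (hd : d ≠ 0) (u v : ℝ) :
    (d : ℝ) ^ (m + n - 1) * ∑ s ∈ Finset.range d,
        bernoulliBar m (a * (s / d + u)) * bernoulliBar n (b * (s / d + v)) =
      reciprocitySum m n a b d (v - u) v + reciprocitySum n m b a d (u - v) u -
      (d : ℝ) ^ (m + n) * ((-1) ^ m * ((m.factorial : ℝ) * n.factorial / (m + n).factorial) *
        ((a.gcd b : ℝ) ^ (m + n) / ((a : ℝ) ^ n * (b : ℝ) ^ m)) *
        bernoulliBar (m + n) ((a * b / a.gcd b : ℕ) * (v - u))) -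
      if m = 1 ∧ n = 1 then (d : ℝ) / 4 * ∑ s ∈ Finset.range d, ∑ h ∈ Finset.range a,
        ∑ k ∈ Finset.range b, deltaInt (s / d + u + h / a) * deltaInt (s / d + v + k / b)
      else 0 := by
  have ha' : (a : ℝ) ≠ 0 := by exact_mod_cast ha
  have hb' : (b : ℝ) ≠ 0 := by exact_mod_cast hb
  have hd' : (d : ℝ) ≠ 0 := by exact_mod_cast hd
  set P : ℝ := (a : ℝ) ^ m / a * ((b : ℝ) ^ n / b) with hP
  -- Raabe's formula is used backwards to remove the multipliers `a` and `b` from the arguments,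
  -- since the product formula needs differences of arguments.
  have h0 : ∀ s ∈ Finset.range d,
      bernoulliBar m (a * (s / d + u)) * bernoulliBar n (b * (s / d + v)) =
      P * ∑ h ∈ Finset.range a, ∑ k ∈ Finset.range b,
        bernoulliBar m (s / d + u + h / a) * bernoulliBar n (s / d + v + k / b) := fun s _ => by
    rw [← Finset.sum_mul_sum, sum_bernoulliBar_add_div _ ha, sum_bernoulliBar_add_div _ hb, hP]
    field_simp
  rw [Finset.sum_congr rfl h0, ← Finset.mul_sum]
  simp only [bernoulliBar_mul hm hn, Finset.sum_sub_distrib, Finset.sum_add_distrib, mul_sub,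
    mul_add]
  congr 1
  · congr 1
    · congr 1
      · rw [← mul_assoc, sum_reciprocity_part hn ha hb hd]
      · rw [← sum_reciprocity_part hm hb ha hd v u, ← mul_assoc, hP, add_comm n m,
          mul_comm ((a : ℝ) ^ m / a)]
        congr 1
        exact Finset.sum_congr rfl fun s _ => Finset.sum_comm
    · rw [Finset.sum_congr rfl (g := fun _ => (-1) ^ n *
        ((m.factorial : ℝ) * n.factorial / (m + n).factorial) *
        ∑ h ∈ Finset.range a, ∑ k ∈ Finset.range b,
          bernoulliBar (m + n) (h / a - ((v - u) + k / b)))]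
      · rw [Finset.sum_const, Finset.card_range, nsmul_eq_mul, sum_sum_bernoulliBar_sub ha hb]
        obtain ⟨m, rfl⟩ := Nat.exists_eq_add_of_le' hm
        have hs : ((-1 : ℝ) ^ n) * (-1) ^ n = 1 := by rw [← mul_pow]; simp
        rw [hP, pow_add (-1 : ℝ), show m + 1 + n - 1 = m + n by omega,
          show m + 1 + n = m + n + 1 by omega, pow_succ (d : ℝ) (m + n)]
        simp only [pow_add, pow_one]
        have hf : ((m + n + 1).factorial : ℝ) ≠ 0 := by positivity
        field_simp
        linear_combination (-bernoulliBar (m + n + 1) ((a * b / a.gcd b : ℕ) * (v - u))) * hs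
      · intro s _
        simp only [Finset.mul_sum]
        refine Finset.sum_congr rfl fun h _ => Finset.sum_congr rfl fun k _ => ?_
        congr 2; ring
  · split_ifs with h
    · obtain ⟨rfl, rfl⟩ := h
      simp only [hP, ← Finset.sum_div, pow_one, div_self ha', div_self hb']
      ring
    · simp

/-! ### The sums `A`, `B`, `C`, `D` at a single divisor, as terms of the reciprocity law. -/

/-- The contribution of a single divisor `d` to `sumA`. -/
noncomputable def sliceA (m₁ m₂ m₃ a b c d : ℕ) : ℝ :=
  (m₃ : ℝ) * (b : ℝ) ^ (m₂ - 1) * (c : ℝ) ^ (m₃ - 1) *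
    ∑ j ∈ Finset.Icc 1 m₂,
      (m₂.choose j : ℝ) * ((-1 : ℝ) ^ j * (j : ℝ) / ((m₂ : ℝ) + m₃ - j)) *
        ∑ j₁ ∈ Finset.range (m₁ + 1),
          (m₁.choose j₁ : ℝ) * ((-1 : ℝ) ^ j₁ * (a : ℝ) ^ (m₁ - j₁) / ((m₁ : ℝ) + j - j₁)) *
            ∑ l ∈ Finset.Icc 1 c, ∑ l₁ ∈ Finset.Icc 1 b,
              bernoulliBar j₁ ((a : ℝ) * l₁ / b + (a : ℝ) * l / c) *
                ((d : ℝ) ^ j₁ *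
                  bernoulliBar (m₂ + m₃ - j) ((d : ℝ) * l / c) *
                  bernoulliBar (m₁ + j - j₁) ((d : ℝ) * l₁ / b + (d : ℝ) * l / c))

/-- The contribution of a single divisor `d` to `sumB`. -/
noncomputable def sliceB (m₁ m₂ m₃ a b c d : ℕ) : ℝ :=
  (m₁ : ℝ) * (m₂ : ℝ) * (a : ℝ) ^ (m₁ - 1) * (b : ℝ) ^ (m₂ - 1) *
    ∑ j ∈ Finset.Icc 1 m₃,
      (m₃.choose j : ℝ) * (1 / ((m₂ : ℝ) + m₃ - j)) *
        ∑ j₁ ∈ Finset.range (j + 1),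
          (j.choose j₁ : ℝ) * ((-1 : ℝ) ^ j₁ * (c : ℝ) ^ (m₃ - j₁) / ((m₁ : ℝ) + j - j₁)) *
            ∑ l ∈ Finset.Icc 1 b, ∑ l₁ ∈ Finset.Icc 1 a,
              bernoulliBar j₁ ((c : ℝ) * l₁ / a + (c : ℝ) * l / b) *
                ((d : ℝ) ^ j₁ *
                  bernoulliBar (m₂ + m₃ - j) ((d : ℝ) * l / b) *
                  bernoulliBar (m₁ + j - j₁) ((d : ℝ) * l₁ / a))

/-- The contribution of a single divisor `d` to `sumC`. -/
noncomputable def sliceC (m₁ m₂ m₃ a b c d : ℕ) : ℝ :=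
  -((m₂ : ℝ) * (m₁.factorial : ℝ) * (b : ℝ) ^ (m₂ - 1) * (a.gcd c : ℝ) ^ m₁ / (c : ℝ) ^ m₁) *
    ∑ j ∈ Finset.Icc 1 m₃,
      (m₃.choose j : ℝ) *
        ((-1 : ℝ) ^ j * (a.gcd c : ℝ) ^ j * (c : ℝ) ^ (m₃ - j) * (j.factorial : ℝ) /
          ((a : ℝ) ^ j * ((m₂ : ℝ) + m₃ - j) * ((m₁ + j).factorial : ℝ))) *
        ∑ l ∈ Finset.Icc 1 b,
          bernoulliBar (m₁ + j) (((a * c / a.gcd c : ℕ) : ℝ) * l / b) *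
            ((d : ℝ) ^ (m₁ + j) * bernoulliBar (m₂ + m₃ - j) ((d : ℝ) * l / b))

/-- The contribution of a single divisor `d` to `sumD`. -/
noncomputable def sliceD (m₁ m₂ m₃ b c d : ℕ) : ℝ :=
  (if m₁ = 1 then 1 else 0) * (m₂ : ℝ) * (m₃ : ℝ) * (b : ℝ) ^ (m₂ - 1) * (c : ℝ) ^ (m₃ - 1) /
      (4 * ((m₂ : ℝ) + m₃ - 1)) *
    ((d : ℝ) ^ m₁ * ∑ l ∈ Finset.Icc 1 b,
        bernoulliBar (m₂ + m₃ - 1) ((d : ℝ) * l / b) * deltaInt ((c : ℝ) * l / b))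

theorem sumA_eq_sum_sliceA (m₁ m₂ m₃ q a b c : ℕ) :
    sumA m₁ m₂ m₃ q a b c =
      ∑ d ∈ q.divisors, (ArithmeticFunction.moebius (q / d) : ℝ) * sliceA m₁ m₂ m₃ a b c d := by
  simp only [sumA, sliceA, Finset.mul_sum]
  rw [Finset.sum_comm (s := q.divisors)]
  refine Finset.sum_congr rfl fun j _ => ?_
  rw [Finset.sum_comm (s := q.divisors)]
  refine Finset.sum_congr rfl fun j _ => ?_
  rw [Finset.sum_comm (s := q.divisors)]
  refine Finset.sum_congr rfl fun j _ => ?_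
  rw [Finset.sum_comm (s := q.divisors)]
  refine Finset.sum_congr rfl fun j _ => Finset.sum_congr rfl fun d _ => ?_
  ring

theorem sumB_eq_sum_sliceB (m₁ m₂ m₃ q a b c : ℕ) :
    sumB m₁ m₂ m₃ q a b c =
      ∑ d ∈ q.divisors, (ArithmeticFunction.moebius (q / d) : ℝ) * sliceB m₁ m₂ m₃ a b c d := by
  simp only [sumB, sliceB, Finset.mul_sum]
  rw [Finset.sum_comm (s := q.divisors)]
  refine Finset.sum_congr rfl fun j _ => ?_
  rw [Finset.sum_comm (s := q.divisors)]
  refine Finset.sum_congr rfl fun j _ => ?_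
  rw [Finset.sum_comm (s := q.divisors)]
  refine Finset.sum_congr rfl fun j _ => ?_
  rw [Finset.sum_comm (s := q.divisors)]
  refine Finset.sum_congr rfl fun j _ => Finset.sum_congr rfl fun d _ => ?_
  ring

theorem sumC_eq_sum_sliceC (m₁ m₂ m₃ q a b c : ℕ) :
    sumC m₁ m₂ m₃ q a b c =
      ∑ d ∈ q.divisors, (ArithmeticFunction.moebius (q / d) : ℝ) * sliceC m₁ m₂ m₃ a b c d := by
  simp only [sumC, sliceC, Finset.mul_sum]
  rw [Finset.sum_comm (s := q.divisors)]
  refine Finset.sum_congr rfl fun j _ => ?_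
  rw [Finset.sum_comm (s := q.divisors)]
  refine Finset.sum_congr rfl fun j _ => Finset.sum_congr rfl fun d _ => ?_
  ring

theorem sumD_eq_sum_sliceD (m₁ m₂ m₃ q b c : ℕ) :
    sumD m₁ m₂ m₃ q b c =
      ∑ d ∈ q.divisors, (ArithmeticFunction.moebius (q / d) : ℝ) * sliceD m₁ m₂ m₃ b c d := by
  simp only [sumD, sliceD, Finset.mul_sum]
  refine Finset.sum_congr rfl fun j _ => Finset.sum_congr rfl fun d _ => ?_
  ring

theorem bernoulliBar_nat_mul_add_one (n e : ℕ) (x : ℝ) :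
    bernoulliBar n (e * (x + 1)) = bernoulliBar n (e * x) := by
  rw [← bernoulliBar_add_int n (e * x) e]
  congr 1; push_cast; ring

theorem bernoulliBar_nat_mul_add_one_add (n e : ℕ) (x z : ℝ) :
    bernoulliBar n (e * (x + 1 + z)) = bernoulliBar n (e * (x + z)) := by
  rw [add_right_comm, bernoulliBar_nat_mul_add_one]

theorem bernoulliBar_nat_mul_add_add_one (n e : ℕ) (x z : ℝ) :
    bernoulliBar n (e * (x + (z + 1))) = bernoulliBar n (e * (x + z)) := by
  rw [← add_assoc, bernoulliBar_nat_mul_add_one]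

theorem deltaInt_nat_mul_add_one (e : ℕ) (x : ℝ) :
    deltaInt (e * (x + 1)) = deltaInt (e * x) := by
  rw [← deltaInt_add_int (e * x) e]
  congr 1; push_cast; ring

theorem Function.Periodic.sum_range_neg {M : Type*} [AddCommMonoid M] {F : ℝ → M}
    (hF : Function.Periodic F 1) {N : ℕ} (hN : N ≠ 0) :
    ∑ i ∈ Finset.range N, F (-((i : ℝ) / N)) = ∑ i ∈ Finset.range N, F ((i : ℝ) / N) := by
  have hN' : (N : ℝ) ≠ 0 := by exact_mod_cast hN
  rw [← hF.sum_Icc_eq_sum_range hN, ← Finset.Ico_add_one_right_eq_Icc, Finset.sum_Ico_eq_sum_range,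
    ← Finset.sum_range_reflect]
  refine Finset.sum_congr rfl fun i hi => ?_
  have := Finset.mem_range.mp hi
  have h1 : ((1 + i : ℕ) : ℝ) = N - (N + 1 - 1 - 1 - i : ℕ) := by
    rw [Nat.add_sub_cancel, Nat.sub_sub, Nat.cast_sub (by omega)]; ring
  rw [← hF, h1, sub_div, div_self hN', neg_add_eq_sub]
  rfl

theorem sumR_eq_sum_reciprocitySum (m n q a : ℕ) {b : ℕ} (hb : b ≠ 0) :
    sumR m n q a b = ∑ d ∈ q.divisors,
      (ArithmeticFunction.moebius (q / d) : ℝ) * reciprocitySum m n a b d 0 0 := by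
  have h : ∀ j d : ℕ, ∑ k ∈ Finset.range b, bernoulliBar j (a * (0 + k / b)) *
        ((d : ℝ) ^ j * bernoulliBar (m + n - j) (d * (0 + k / b))) =
      ∑ l ∈ Finset.Icc 1 b, bernoulliBar j ((a : ℝ) * l / b) *
        ((d : ℝ) ^ j * bernoulliBar (m + n - j) ((d : ℝ) * l / b)) := fun j d => by
    have hF : Function.Periodic (fun x : ℝ => bernoulliBar j (a * x) *
        ((d : ℝ) ^ j * bernoulliBar (m + n - j) (d * x))) 1 := fun x => by
      simp only [bernoulliBar_nat_mul_add_one]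
    simpa only [zero_add, mul_div_assoc] using (hF.sum_Icc_eq_sum_range hb).symm
  simp only [sumR, reciprocitySum, h, Finset.mul_sum]
  rw [Finset.sum_comm (s := q.divisors)]
  refine Finset.sum_congr rfl fun j _ => ?_
  rw [Finset.sum_comm (s := q.divisors)]
  refine Finset.sum_congr rfl fun j _ => Finset.sum_congr rfl fun d _ => ?_
  ring

theorem sum_deltaInt_add_div {b : ℕ} (hb : b ≠ 0) (x : ℝ) :
    ∑ k ∈ Finset.range b, deltaInt (x + k / b) = deltaInt (b * x) := by
  have hb' : (0 : ℝ) < b := by exact_mod_cast Nat.pos_of_ne_zero hb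
  have hper : Function.Periodic deltaInt 1 := fun x => by simpa using deltaInt_add_int x 1
  by_cases h : ∃ n : ℤ, (n : ℝ) = b * x
  · obtain ⟨n, hn⟩ := h
    have hx : x = n / b := by rw [hn]; field_simp
    have key := hper.sum_range_add_mul_div hb (Nat.coprime_one_left b) 0 n
    have h1 : ∀ k ∈ Finset.range b, deltaInt (0 + k / b) = if k = 0 then 1 else 0 := by
      intro k hk
      have hk' : (k : ℝ) < b := by exact_mod_cast Finset.mem_range.mp hk
      rw [zero_add, deltaInt_fract,
        Int.fract_eq_self.mpr ⟨by positivity, (div_lt_one hb').mpr hk'⟩]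
      simp [hb'.ne']
    rw [Finset.sum_congr rfl h1, Finset.sum_ite_eq',
      if_pos (Finset.mem_range.mpr (Nat.pos_of_ne_zero hb))] at key
    rw [deltaInt, if_pos ⟨n, hn⟩, ← key]
    refine Finset.sum_congr rfl fun k _ => ?_
    congr 1; rw [hx]; push_cast; ring
  · rw [deltaInt, if_neg h]
    refine Finset.sum_eq_zero fun k _ => ?_
    rw [deltaInt, if_neg]
    rintro ⟨n, hn⟩
    refine h ⟨n * b - k, ?_⟩
    push_cast
    rw [hn]; field_simp; ring

/-- Summing over `h` and `k` leaves the indicators of `as/d` and `b(s/d + v)`. As `a` is prime to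
`d`, only `s = 0` survives. -/
theorem sum_sum_sum_deltaInt {a b d : ℕ} (ha : a ≠ 0) (hb : b ≠ 0) (hd : d ≠ 0)
    (had : a.Coprime d) (v : ℝ) :
    ∑ s ∈ Finset.range d, ∑ h ∈ Finset.range a, ∑ k ∈ Finset.range b,
      deltaInt (s / d + 0 + h / a) * deltaInt (s / d + v + k / b) = deltaInt (b * v) := by
  have hd' : (d : ℝ) ≠ 0 := by exact_mod_cast hd
  simp only [← Finset.sum_mul_sum, sum_deltaInt_add_div ha, sum_deltaInt_add_div hb]
  rw [Finset.sum_eq_single 0]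
  · simp [deltaInt_fract]
  · intro s hs hs0
    rw [deltaInt, if_neg, zero_mul]
    rintro ⟨n, hn⟩
    have h1 : (a * s : ℤ) = n * d := by
      have : (a * s : ℝ) = n * d := by rw [hn]; field_simp; ring
      exact_mod_cast this
    have h2 : d ∣ a * s := by
      have : (d : ℤ) ∣ (a * s : ℤ) := ⟨n, by rw [h1, mul_comm]⟩
      exact_mod_cast this
    have h3 := Nat.le_of_dvd (Nat.pos_of_ne_zero hs0) (had.symm.dvd_of_dvd_mul_left h2)
    exact absurd (Finset.mem_range.mp hs) (by omega)
  · intro h; exact absurd (Finset.mem_range.mpr (Nat.pos_of_ne_zero hd)) h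

theorem sum_Icc_sum_Icc_eq {M : Type*} [AddCommMonoid M] {F : ℝ → ℝ → M}
    (h1 : ∀ y, Function.Periodic (fun x => F x y) 1) (h2 : ∀ x, Function.Periodic (F x) 1)
    {c b : ℕ} (hc : c ≠ 0) (hb : b ≠ 0) :
    ∑ l ∈ Finset.Icc 1 c, ∑ k ∈ Finset.Icc 1 b, F ((l : ℝ) / c) ((k : ℝ) / b) =
      ∑ l ∈ Finset.range c, ∑ k ∈ Finset.range b, F ((l : ℝ) / c) ((k : ℝ) / b) := by
  simp only [(h2 _).sum_Icc_eq_sum_range hb]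
  exact Function.Periodic.sum_Icc_eq_sum_range
    (F := fun x => ∑ k ∈ Finset.range b, F x ((k : ℝ) / b))
    (fun x => Finset.sum_congr rfl fun k _ => h1 _ x) hc

/-- The outer coefficient when the reciprocity law is applied to the inner sum. -/
noncomputable def outerCoeff (m₂ m₃ b c j : ℕ) : ℝ :=
  m₃ * (c : ℝ) ^ (m₃ - 1) *
    ((m₂.choose j : ℝ) * ((-1) ^ j * (b : ℝ) ^ (m₂ - j) / ((m₂ : ℝ) + m₃ - j)))

section

variable {m₁ m₂ m₃ a b c : ℕ}

/-- This and the next three lemmas recognise the four terms on the right of `inner_reciprocity`,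
weighted by `outerCoeff` and summed over `j ≥ 1` and `k` mod `c`. `A` occurs with its arguments in
the original order; `B`, `C` and `D` occur with `(m₂, b)` and `(m₃, c)` interchanged. -/
theorem sliceA_eq (d : ℕ) (hb : b ≠ 0) (hc : c ≠ 0) :
    sliceA m₁ m₂ m₃ a b c d = ∑ j ∈ Finset.Icc 1 m₂, outerCoeff m₂ m₃ b c j *
      ∑ k ∈ Finset.range c, bernoulliBar (m₂ + m₃ - j) (d * (k / c)) *
        reciprocitySum m₁ j a b d (k / c) (k / c) := by
  have h : ∀ j j₁, ∑ l ∈ Finset.Icc 1 c, ∑ l₁ ∈ Finset.Icc 1 b,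
              bernoulliBar j₁ ((a : ℝ) * l₁ / b + (a : ℝ) * l / c) *
                ((d : ℝ) ^ j₁ *
                  bernoulliBar (m₂ + m₃ - j) ((d : ℝ) * l / c) *
                  bernoulliBar (m₁ + j - j₁) ((d : ℝ) * l₁ / b + (d : ℝ) * l / c)) =
      ∑ l ∈ Finset.range c, ∑ l₁ ∈ Finset.range b, bernoulliBar j₁ (a * (l / c + l₁ / b)) *
        ((d : ℝ) ^ j₁ * bernoulliBar (m₂ + m₃ - j) (d * (l / c)) *
          bernoulliBar (m₁ + j - j₁) (d * (l / c + l₁ / b))) := by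
    intro j j₁
    rw [← sum_Icc_sum_Icc_eq (F := fun x y => bernoulliBar j₁ (a * (x + y)) *
        ((d : ℝ) ^ j₁ * bernoulliBar (m₂ + m₃ - j) (d * x) *
          bernoulliBar (m₁ + j - j₁) (d * (x + y)))) _ _ hc hb]
    · refine Finset.sum_congr rfl fun l _ => Finset.sum_congr rfl fun k _ => ?_
      congr 2
      · ring
      · congr 1; ring_nf
      · ring_nf
    · intro y x
      simp only [bernoulliBar_nat_mul_add_one_add, bernoulliBar_nat_mul_add_one]
    · intro x y
      simp only [bernoulliBar_nat_mul_add_add_one]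
  simp only [sliceA, outerCoeff, reciprocitySum, h]
  rw [Finset.mul_sum]
  refine Finset.sum_congr rfl fun j hj => ?_
  obtain ⟨hj1, hj2⟩ := Finset.mem_Icc.mp hj
  have hp : (b : ℝ) ^ (m₂ - 1) = b ^ (m₂ - j) * b ^ (j - 1) := by
    rw [← pow_add]; congr 1; omega
  simp only [Finset.mul_sum]
  rw [Finset.sum_comm]
  refine Finset.sum_congr rfl fun l _ => Finset.sum_congr rfl fun i _ =>
    Finset.sum_congr rfl fun k _ => ?_
  rw [hp]; ring

theorem sliceB_eq {d : ℕ} (hpar : m₁ + m₂ ≡ m₃ [MOD 2]) (ha : a ≠ 0) (hc : c ≠ 0) :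
    (-1) ^ m₁ * sliceB m₁ m₃ m₂ a c b d = ∑ j ∈ Finset.Icc 1 m₂, outerCoeff m₂ m₃ b c j *
      ∑ k ∈ Finset.range c, bernoulliBar (m₂ + m₃ - j) (d * (k / c)) *
        reciprocitySum j m₁ b a d (-(k / c)) 0 := by
  have h : ∀ j j₁, ∑ l ∈ Finset.Icc 1 c, ∑ l₁ ∈ Finset.Icc 1 a,
              bernoulliBar j₁ ((b : ℝ) * l₁ / a + (b : ℝ) * l / c) *
                ((d : ℝ) ^ j₁ *
                  bernoulliBar (m₃ + m₂ - j) ((d : ℝ) * l / c) *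
                  bernoulliBar (m₁ + j - j₁) ((d : ℝ) * l₁ / a)) =
      (-1) ^ (m₃ + m₂ - j) *
      ∑ l ∈ Finset.range c, ∑ l₁ ∈ Finset.range a, bernoulliBar j₁ (b * (-(l / c) + l₁ / a)) *
        ((d : ℝ) ^ j₁ * bernoulliBar (m₃ + m₂ - j) (d * (l / c)) *
          bernoulliBar (m₁ + j - j₁) (d * (l₁ / a))) := by
    intro j j₁
    have hF1 : ∀ y, Function.Periodic (fun x : ℝ => bernoulliBar j₁ (b * (x + y)) *
        ((d : ℝ) ^ j₁ * bernoulliBar (m₃ + m₂ - j) (d * x) *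
          bernoulliBar (m₁ + j - j₁) (d * y))) 1 := by
      intro y x
      simp only [bernoulliBar_nat_mul_add_one_add, bernoulliBar_nat_mul_add_one]
    rw [Finset.mul_sum]
    trans ∑ l ∈ Finset.range c, ∑ k ∈ Finset.range a,
      bernoulliBar j₁ (b * ((l : ℝ) / c + k / a)) *
        ((d : ℝ) ^ j₁ * bernoulliBar (m₃ + m₂ - j) (d * (l / c)) *
          bernoulliBar (m₁ + j - j₁) (d * (k / a)))
    · rw [← sum_Icc_sum_Icc_eq (F := fun x y => bernoulliBar j₁ (b * (x + y)) *
        ((d : ℝ) ^ j₁ * bernoulliBar (m₃ + m₂ - j) (d * x) *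
          bernoulliBar (m₁ + j - j₁) (d * y))) hF1 _ hc ha]
      · refine Finset.sum_congr rfl fun l _ => Finset.sum_congr rfl fun k _ => ?_
        congr 2
        · ring
        · congr 1; ring_nf
        · ring_nf
      · intro x y
        simp only [bernoulliBar_nat_mul_add_add_one, bernoulliBar_nat_mul_add_one]
    · rw [← Function.Periodic.sum_range_neg (F := fun x : ℝ => ∑ k ∈ Finset.range a,
        bernoulliBar j₁ (b * (x + k / a)) *
        ((d : ℝ) ^ j₁ * bernoulliBar (m₃ + m₂ - j) (d * x) *
          bernoulliBar (m₁ + j - j₁) (d * (k / a))))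
          (fun x => Finset.sum_congr rfl fun k _ => hF1 _ x) hc]
      refine Finset.sum_congr rfl fun l _ => ?_
      rw [Finset.mul_sum]
      refine Finset.sum_congr rfl fun k _ => ?_
      rw [mul_neg, bernoulliBar_neg]
      ring
  simp only [sliceB, outerCoeff, reciprocitySum, h, zero_add]
  rw [Finset.mul_sum, Finset.mul_sum]
  refine Finset.sum_congr rfl fun j hj => ?_
  obtain ⟨hj1, hj2⟩ := Finset.mem_Icc.mp hj
  -- The substitution `l ↦ -l` produced the sign `(-1)^(m₃+m₂-j)`; the parity condition reduces it
  -- to `(-1)^j`, the sign in `outerCoeff`.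
  have hsgn : (-1 : ℝ) ^ m₁ * (-1) ^ (m₃ + m₂ - j) = (-1) ^ j := by
    rw [← pow_add]
    have : m₁ + (m₃ + m₂ - j) ≡ j [MOD 2] := by
      unfold Nat.ModEq at *; omega
    rw [neg_one_pow_eq_pow_mod_two, this, ← neg_one_pow_eq_pow_mod_two]
  simp only [Finset.mul_sum]
  rw [Finset.sum_comm]
  refine Finset.sum_congr rfl fun l _ => Finset.sum_congr rfl fun i hi =>
    Finset.sum_congr rfl fun k _ => ?_
  have hi' := Finset.mem_range.mp hi
  have hp : (b : ℝ) ^ (m₂ - i) = b ^ (m₂ - j) * b ^ (j - i) := by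
    rw [← pow_add]; congr 1; omega
  rw [hp, ← hsgn, add_comm m₃ m₂, add_comm m₁ j, add_comm (m₁ : ℝ) j, add_comm (m₃ : ℝ) m₂]
  ring

theorem sliceC_eq (d : ℕ) (ha : a ≠ 0) (hb : b ≠ 0) (hc : c ≠ 0) :
    (-1) ^ m₁ * sliceC m₁ m₃ m₂ a c b d = ∑ j ∈ Finset.Icc 1 m₂, outerCoeff m₂ m₃ b c j *
      ∑ k ∈ Finset.range c, bernoulliBar (m₂ + m₃ - j) (d * (k / c)) *
        -((d : ℝ) ^ (m₁ + j) *
          ((-1) ^ m₁ * ((m₁.factorial : ℝ) * j.factorial / (m₁ + j).factorial) *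
          ((a.gcd b : ℝ) ^ (m₁ + j) / ((a : ℝ) ^ j * (b : ℝ) ^ m₁)) *
          bernoulliBar (m₁ + j) ((a * b / a.gcd b : ℕ) * (k / c)))) := by
  have h : ∀ j, ∑ l ∈ Finset.Icc 1 c,
          bernoulliBar (m₁ + j) (((a * b / a.gcd b : ℕ) : ℝ) * l / c) *
            ((d : ℝ) ^ (m₁ + j) * bernoulliBar (m₃ + m₂ - j) ((d : ℝ) * l / c)) =
      ∑ l ∈ Finset.range c,
          bernoulliBar (m₁ + j) (((a * b / a.gcd b : ℕ) : ℝ) * (l / c)) *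
            ((d : ℝ) ^ (m₁ + j) * bernoulliBar (m₃ + m₂ - j) ((d : ℝ) * (l / c))) := by
    intro j
    rw [← Function.Periodic.sum_Icc_eq_sum_range (F := fun x : ℝ =>
      bernoulliBar (m₁ + j) (((a * b / a.gcd b : ℕ) : ℝ) * x) *
            ((d : ℝ) ^ (m₁ + j) * bernoulliBar (m₃ + m₂ - j) ((d : ℝ) * x))) (fun x => by
        simp only [bernoulliBar_nat_mul_add_one]) hc]
    simp only [mul_div_assoc]
  simp only [sliceC, outerCoeff, h]
  rw [Finset.mul_sum, Finset.mul_sum]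
  refine Finset.sum_congr rfl fun j hj => ?_
  simp only [Finset.mul_sum]
  refine Finset.sum_congr rfl fun l _ => ?_
  have ha' : (a : ℝ) ≠ 0 := by exact_mod_cast ha
  have hb' : (b : ℝ) ≠ 0 := by exact_mod_cast hb
  rw [add_comm m₃ m₂, add_comm (m₃ : ℝ) m₂, pow_add (a.gcd b : ℝ)]
  simp only [div_eq_mul_inv, mul_inv]
  ring

theorem sliceD_eq {d : ℕ} (hm₂ : 1 ≤ m₂) (hc : c ≠ 0) :
    sliceD m₁ m₃ m₂ c b d = ∑ j ∈ Finset.Icc 1 m₂, outerCoeff m₂ m₃ b c j *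
      ∑ k ∈ Finset.range c, bernoulliBar (m₂ + m₃ - j) (d * (k / c)) *
        -(if m₁ = 1 ∧ j = 1 then (d : ℝ) / 4 * deltaInt (b * (k / c)) else 0) := by
  rw [Finset.sum_eq_single_of_mem 1 (Finset.mem_Icc.mpr ⟨le_rfl, hm₂⟩)]
  · have h : ∑ l ∈ Finset.Icc 1 c,
        bernoulliBar (m₃ + m₂ - 1) ((d : ℝ) * l / c) * deltaInt ((b : ℝ) * l / c) =
        ∑ l ∈ Finset.range c,
          bernoulliBar (m₃ + m₂ - 1) ((d : ℝ) * (l / c)) * deltaInt ((b : ℝ) * (l / c)) := by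
      rw [← Function.Periodic.sum_Icc_eq_sum_range (F := fun x : ℝ =>
        bernoulliBar (m₃ + m₂ - 1) ((d : ℝ) * x) * deltaInt ((b : ℝ) * x)) (fun x => by
        simp only [bernoulliBar_nat_mul_add_one, deltaInt_nat_mul_add_one]) hc]
      simp only [mul_div_assoc]
    by_cases hm : m₁ = 1
    · simp only [sliceD, outerCoeff, h, hm, Finset.mul_sum, true_and, if_true]
      refine Finset.sum_congr rfl fun l _ => ?_
      rw [add_comm m₃ m₂, add_comm (m₃ : ℝ) m₂]
      simp only [Nat.choose_one_right, div_eq_mul_inv, mul_inv, Nat.cast_one]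
      ring
    · simp [sliceD, hm]
  · intro j _ hj
    simp [hj]

end

/-! ### Reciprocity for the triple Dedekind sum. -/

section

variable {m₁ m₂ m₃ a b c d : ℕ}

theorem inner_reciprocity {j : ℕ} (hm₁ : 1 ≤ m₁) (hj : 1 ≤ j) (ha : a ≠ 0) (hb : b ≠ 0)
    (hd : d ≠ 0) (had : a.Coprime d) (v : ℝ) :
    (d : ℝ) ^ (m₁ + j - 1) * ∑ r ∈ Finset.range d,
        bernoulliBar m₁ (a * (r / d)) * bernoulliBar j (b * (r / d + v)) =
      reciprocitySum m₁ j a b d v v + reciprocitySum j m₁ b a d (-v) 0 +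
      -((d : ℝ) ^ (m₁ + j) *
          ((-1) ^ m₁ * ((m₁.factorial : ℝ) * j.factorial / (m₁ + j).factorial) *
          ((a.gcd b : ℝ) ^ (m₁ + j) / ((a : ℝ) ^ j * (b : ℝ) ^ m₁)) *
          bernoulliBar (m₁ + j) ((a * b / a.gcd b : ℕ) * v))) +
      -(if m₁ = 1 ∧ j = 1 then (d : ℝ) / 4 * deltaInt (b * v) else 0) := by
  have h := dedekind_rademacher_reciprocity hm₁ hj ha hb hd 0 v
  rw [sum_sum_sum_deltaInt ha hb hd had] at h
  simp only [add_zero, sub_zero, zero_sub] at h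
  rw [h]; ring

/-- The contribution of the terms which do not depend on `d`. -/
noncomputable def constantPart (m₁ m₂ m₃ b c : ℕ) : ℝ :=
  outerCoeff m₂ m₃ b c 0 * (c / (c : ℝ) ^ (m₂ + m₃) * bernoulliBar (m₂ + m₃) 0) * bernoulliBar m₁ 0

/-- The argument `d(r/d + k/c)` differs from `dk/c` by the integer `r`, so `r` survives only in
`B̄ⱼ(b(r/d + k/c))`. For `j ≥ 1` the sum over `r` is again of Dedekind–Rademacher type. For `j = 0`
it is a plain Raabe sum, whose power of `d` cancels `d^(m₁-1)`; this is the part independent of `d`.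
-/
theorem sum_bernoulliBar_mul_reciprocitySum (hm₁ : 1 ≤ m₁) (hm₂ : 1 ≤ m₂)
    (hpar : m₁ + m₂ ≡ m₃ [MOD 2]) (ha : a ≠ 0) (hb : b ≠ 0) (hc : c ≠ 0) (hd : d ≠ 0)
    (had : a.Coprime d) (hcd : c.Coprime d) :
    (d : ℝ) ^ (m₁ - 1) * ∑ r ∈ Finset.range d,
        bernoulliBar m₁ (a * (r / d)) * reciprocitySum m₂ m₃ b c d (r / d) (r / d) =
      constantPart m₁ m₂ m₃ b c + sliceA m₁ m₂ m₃ a b c d +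
        (-1) ^ m₁ * sliceB m₁ m₃ m₂ a c b d + (-1) ^ m₁ * sliceC m₁ m₃ m₂ a c b d +
        sliceD m₁ m₃ m₂ c b d := by
  have hd' : (d : ℝ) ≠ 0 := by exact_mod_cast hd
  have h1 : ∀ r k j : ℕ, bernoulliBar j (d * (r / d + k / c)) = bernoulliBar j (d * (k / c)) := by
    intro r k j
    rw [← bernoulliBar_add_int j (d * (k / c)) r]
    congr 1; push_cast; field_simp; ring
  have h2 : (d : ℝ) ^ (m₁ - 1) * ∑ r ∈ Finset.range d,
        bernoulliBar m₁ (a * (r / d)) * reciprocitySum m₂ m₃ b c d (r / d) (r / d) =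
      ∑ j ∈ Finset.range (m₂ + 1), outerCoeff m₂ m₃ b c j *
        ∑ k ∈ Finset.range c, bernoulliBar (m₂ + m₃ - j) (d * (k / c)) *
          ((d : ℝ) ^ (m₁ - 1) * (d : ℝ) ^ j * ∑ r ∈ Finset.range d,
            bernoulliBar m₁ (a * (r / d)) * bernoulliBar j (b * (r / d + k / c))) := by
    simp only [reciprocitySum, outerCoeff, h1, Finset.mul_sum]
    rw [Finset.sum_comm]
    refine Finset.sum_congr rfl fun j _ => ?_
    rw [Finset.sum_comm]
    refine Finset.sum_congr rfl fun k _ => Finset.sum_congr rfl fun r _ => ?_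
    ring
  have h3 : outerCoeff m₂ m₃ b c 0 *
        ∑ k ∈ Finset.range c, bernoulliBar (m₂ + m₃ - 0) (d * (k / c)) *
          ((d : ℝ) ^ (m₁ - 1) * (d : ℝ) ^ 0 * ∑ r ∈ Finset.range d,
            bernoulliBar m₁ (a * (r / d)) * bernoulliBar 0 (b * (r / d + k / c))) =
      constantPart m₁ m₂ m₃ b c := by
    have e1 := sum_bernoulliBar_add_mul_div_of_coprime m₁ hd had 0
    have e2 := sum_bernoulliBar_add_mul_div_of_coprime (m₂ + m₃) hc hcd.symm 0
    simp only [zero_add, mul_div_assoc, mul_zero] at e1 e2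
    obtain ⟨m, rfl⟩ := Nat.exists_eq_add_of_le' hm₁
    simp only [bernoulliBar_zero_left, mul_one, pow_zero, Nat.sub_zero, e1, ← Finset.sum_mul, e2,
      constantPart, Nat.add_sub_cancel]
    rw [pow_succ]
    field_simp
  rw [h2, Finset.range_eq_Ico, Finset.sum_eq_sum_Ico_succ_bot (by omega), h3, add_assoc, add_assoc,
    add_assoc]
  congr 1
  rw [sliceA_eq d hb hc, sliceB_eq hpar ha hc, sliceC_eq d ha hb hc, sliceD_eq hm₂ hc,
    ← Finset.sum_add_distrib, ← Finset.sum_add_distrib, ← Finset.sum_add_distrib,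
    zero_add, Finset.Ico_add_one_right_eq_Icc]
  refine Finset.sum_congr rfl fun j hj => ?_
  have hj1 := (Finset.mem_Icc.mp hj).1
  rw [← mul_add, ← mul_add, ← mul_add, ← Finset.sum_add_distrib, ← Finset.sum_add_distrib,
    ← Finset.sum_add_distrib]
  congr 1
  refine Finset.sum_congr rfl fun k _ => ?_
  rw [← pow_add, show m₁ - 1 + j = m₁ + j - 1 by omega, inner_reciprocity hm₁ hj1 ha hb hd had]
  ring

/-- The substitution `k ↦ -k` and the parity of the Bernoulli functions give the sign. It brings
both sums from the inner reciprocity law to the shape that `sum_bernoulliBar_mul_reciprocitySum`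
accepts. -/
theorem reciprocitySum_neg_zero (m n : ℕ) (a b : ℕ) (r : ℕ) (hb : b ≠ 0) (hd : d ≠ 0) :
    reciprocitySum m n a b d (-(r / d)) 0 =
      (-1) ^ (m + n) * reciprocitySum m n a b d (r / d) (r / d) := by
  have hd' : (d : ℝ) ≠ 0 := by exact_mod_cast hd
  have h1 : ∀ k j : ℕ, bernoulliBar j (d * (r / d + k / b)) = bernoulliBar j (d * (k / b)) := by
    intro k j
    rw [← bernoulliBar_add_int j (d * (k / b)) r]
    congr 1; push_cast; field_simp; ring
  simp only [reciprocitySum, h1, zero_add]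
  rw [mul_left_comm]
  congr 1
  rw [Finset.mul_sum]
  refine Finset.sum_congr rfl fun j hj => ?_
  have hj' : j ≤ m := Nat.lt_succ_iff.mp (Finset.mem_range.mp hj)
  rw [mul_left_comm]
  congr 1
  rw [← Function.Periodic.sum_range_neg (F := fun x : ℝ => bernoulliBar j (a * (-(r / d) + x)) *
      ((d : ℝ) ^ j * bernoulliBar (m + n - j) (d * x))) (fun x => by
        simp only [bernoulliBar_nat_mul_add_add_one, bernoulliBar_nat_mul_add_one]) hb,
    Finset.mul_sum]
  refine Finset.sum_congr rfl fun k _ => ?_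
  rw [show (a : ℝ) * (-(r / d) + -(k / b)) = -(a * (r / d + k / b)) by ring, mul_neg,
    bernoulliBar_neg, bernoulliBar_neg, show m + n = j + (m + n - j) by omega, pow_add,
    Nat.add_sub_cancel_left]
  ring

/-- The triple Dedekind sum built from Bernoulli functions. -/
noncomputable def tripleDedekindSum (m₁ m₂ m₃ a b c d : ℕ) : ℝ :=
  ∑ r ∈ Finset.range d, bernoulliBar m₁ (a * (r / d)) * ∑ s ∈ Finset.range d,
    bernoulliBar m₂ (b * (s / d)) * bernoulliBar m₃ (c * (s / d + r / d))

/-- **Reciprocity law** for the triple Dedekind sum. -/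
theorem tripleDedekindSum_reciprocity (hm₁ : 1 ≤ m₁) (hm₂ : 1 ≤ m₂) (hm₃ : 2 ≤ m₃)
    (hpar : m₁ + m₂ ≡ m₃ [MOD 2]) (ha : a ≠ 0) (hb : b ≠ 0) (hc : c ≠ 0) (hd : d ≠ 0)
    (had : a.Coprime d) (hbd : b.Coprime d) (hcd : c.Coprime d) :
    (d : ℝ) ^ (m₁ + m₂ + m₃ - 2) * tripleDedekindSum m₁ m₂ m₃ a b c d =
      (constantPart m₁ m₂ m₃ b c + (-1) ^ m₁ * constantPart m₁ m₃ m₂ c b) +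
      (sliceA m₁ m₂ m₃ a b c d + (-1) ^ m₁ * sliceA m₁ m₃ m₂ a c b d +
        sliceB m₁ m₂ m₃ a b c d + (-1) ^ m₁ * sliceB m₁ m₃ m₂ a c b d +
        sliceC m₁ m₂ m₃ a b c d + (-1) ^ m₁ * sliceC m₁ m₃ m₂ a c b d -
        sliceD m₁ m₂ m₃ b c d + sliceD m₁ m₃ m₂ c b d) -
      (-1) ^ m₂ * ((m₂.factorial : ℝ) * m₃.factorial / (m₂ + m₃).factorial) *
        ((b.gcd c : ℝ) ^ (m₂ + m₃) / ((b : ℝ) ^ m₃ * (c : ℝ) ^ m₂)) *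
        (reciprocitySum m₁ (m₂ + m₃) a (b * c / b.gcd c) d 0 0 +
          reciprocitySum (m₂ + m₃) m₁ (b * c / b.gcd c) a d 0 0 -
          (d : ℝ) ^ (m₁ + (m₂ + m₃)) *
          ((-1) ^ m₁ * ((m₁.factorial : ℝ) * (m₂ + m₃).factorial / (m₁ + (m₂ + m₃)).factorial) *
          ((a.gcd (b * c / b.gcd c) : ℝ) ^ (m₁ + (m₂ + m₃)) /
            ((a : ℝ) ^ (m₂ + m₃) * ((b * c / b.gcd c : ℕ) : ℝ) ^ m₁)) *
          bernoulliBar (m₁ + (m₂ + m₃)) 0)) := by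
  have hL : b * c / b.gcd c ≠ 0 := by
    have := Nat.div_pos (Nat.le_of_dvd (Nat.mul_pos (Nat.pos_of_ne_zero hb) (Nat.pos_of_ne_zero hc))
      ((Nat.gcd_dvd_left b c).mul_right c)) (Nat.gcd_pos_of_pos_left c (Nat.pos_of_ne_zero hb))
    omega
  have hpar' : m₁ + m₃ ≡ m₂ [MOD 2] := by unfold Nat.ModEq at *; omega
  have hsgn : (-1 : ℝ) ^ (m₃ + m₂) = (-1) ^ m₁ := by
    have : m₃ + m₂ ≡ m₁ [MOD 2] := by unfold Nat.ModEq at *; omega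
    rw [neg_one_pow_eq_pow_mod_two, this, ← neg_one_pow_eq_pow_mod_two]
  have hs : ((-1 : ℝ) ^ m₁) * (-1) ^ m₁ = 1 := by rw [← mul_pow]; simp
  -- `D` vanishes unless `m₁ = 1`, so the sign `(-1)^m₁` is always `-1` where it matters.
  have hD : (-1 : ℝ) ^ m₁ * sliceD m₁ m₂ m₃ b c d = -sliceD m₁ m₂ m₃ b c d := by
    by_cases h : m₁ = 1
    · rw [h]; ring
    · simp [sliceD, h]
  -- Reciprocity for the sum over `s`. The delta term would need `m₂ = m₃ = 1`, which `m₃ ≥ 2`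
  -- excludes.
  have hin : ∀ r ∈ Finset.range d, (d : ℝ) ^ (m₂ + m₃ - 1) * ∑ s ∈ Finset.range d,
      bernoulliBar m₂ (b * (s / d)) * bernoulliBar m₃ (c * (s / d + r / d)) =
      reciprocitySum m₂ m₃ b c d (r / d) (r / d) +
        (-1) ^ m₁ * reciprocitySum m₃ m₂ c b d (r / d) (r / d) -
      (d : ℝ) ^ (m₂ + m₃) * ((-1) ^ m₂ * ((m₂.factorial : ℝ) * m₃.factorial / (m₂ + m₃).factorial) *
        ((b.gcd c : ℝ) ^ (m₂ + m₃) / ((b : ℝ) ^ m₃ * (c : ℝ) ^ m₂)) *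
        bernoulliBar (m₂ + m₃) ((b * c / b.gcd c : ℕ) * (r / d))) := fun r _ => by
    rw [inner_reciprocity hm₂ (by omega) hb hc hd hbd, reciprocitySum_neg_zero _ _ _ _ _ hb hd,
      if_neg (by omega), hsgn]
    ring
  -- The last term of `hin` involves `B̄_{m₂+m₃}(Lr/d)` with `L = lcm(b, c)`. Summed against
  -- `B̄_{m₁}(ar/d)` it is a two-factor Dedekind sum, which gives the two `R` terms.
  have hout := inner_reciprocity (j := m₂ + m₃) hm₁ (by omega) ha hL hd had 0
  rw [if_neg (by omega)] at hout
  simp only [add_zero, neg_zero, mul_zero] at hout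
  have hQ := sum_bernoulliBar_mul_reciprocitySum hm₁ hm₂ hpar ha hb hc hd had hcd
  have hQ' := sum_bernoulliBar_mul_reciprocitySum hm₁ (by omega) hpar' ha hc hb hd had hbd
  have hsplit : (d : ℝ) ^ (m₁ + m₂ + m₃ - 2) * tripleDedekindSum m₁ m₂ m₃ a b c d =
      (d : ℝ) ^ (m₁ - 1) * ∑ r ∈ Finset.range d, bernoulliBar m₁ (a * (r / d)) *
        ((d : ℝ) ^ (m₂ + m₃ - 1) * ∑ s ∈ Finset.range d,
          bernoulliBar m₂ (b * (s / d)) * bernoulliBar m₃ (c * (s / d + r / d))) := by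
    rw [tripleDedekindSum, show m₁ + m₂ + m₃ - 2 = (m₁ - 1) + (m₂ + m₃ - 1) by omega, pow_add,
      mul_assoc, Finset.mul_sum (a := (d : ℝ) ^ (m₂ + m₃ - 1))]
    simp only [mul_left_comm]
  have hpow : (d : ℝ) ^ (m₁ - 1) * (d : ℝ) ^ (m₂ + m₃) = (d : ℝ) ^ (m₁ + (m₂ + m₃) - 1) := by
    rw [← pow_add]; congr 1; omega
  have hsum : ∀ f g h : ℕ → ℝ, ∀ e K : ℝ, ∑ r ∈ Finset.range d, bernoulliBar m₁ (a * (r / d)) *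
      (f r + e * g r - (d : ℝ) ^ (m₂ + m₃) * (K * h r)) =
      ∑ r ∈ Finset.range d, bernoulliBar m₁ (a * (r / d)) * f r +
      e * ∑ r ∈ Finset.range d, bernoulliBar m₁ (a * (r / d)) * g r -
      (d : ℝ) ^ (m₂ + m₃) * (K * ∑ r ∈ Finset.range d, bernoulliBar m₁ (a * (r / d)) * h r) := by
    intro f g h e K
    simp only [Finset.mul_sum, ← Finset.sum_add_distrib, ← Finset.sum_sub_distrib]
    exact Finset.sum_congr rfl fun r _ => by ring
  rw [hsplit, Finset.sum_congr rfl fun r hr => by rw [hin r hr], hsum]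
  rw [mul_sub, mul_add, mul_left_comm _ ((-1 : ℝ) ^ m₁), hQ, hQ', ← mul_assoc ((d : ℝ) ^ (m₁ - 1)),
    hpow, mul_left_comm ((d : ℝ) ^ (m₁ + (m₂ + m₃) - 1)), hout]
  linear_combination hD + (sliceB m₁ m₂ m₃ a b c d + sliceC m₁ m₂ m₃ a b c d) * hs

end

/-! ### Values of the periodic zeta function at positive integers. -/

open Complex in
theorem one_sub_mul_exp_neg_mem_slitPlane {z : ℂ} (hz : ‖z‖ = 1) (hz1 : z ≠ 1) {t : ℝ}
    (ht : 0 ≤ t) : 1 - z * Real.exp (-t) ∈ slitPlane := by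
  left
  have hre : z.re < 1 := by
    refine lt_of_le_of_ne (hz ▸ re_le_norm z) fun h => hz1 ?_
    have h1 : z.re ^ 2 + z.im ^ 2 = 1 := by
      have := Complex.sq_norm z
      rw [hz, normSq_apply] at this
      nlinarith
    have h2 : z.im = 0 := by
      rw [h] at h1; nlinarith
    exact Complex.ext h h2
  have h1 : (z * Real.exp (-t)).re = z.re * Real.exp (-t) := re_mul_ofReal z _
  have h2 : Real.exp (-t) ≤ 1 := Real.exp_le_one_iff.mpr (by linarith)
  have h3 := Real.exp_pos (-t)
  rw [sub_re, one_re, h1]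
  rcases le_or_gt z.re 0 with h | h <;> nlinarith

-- With `z = e^{2πix}`, the Mellin transform of `F(t) = ∑ zⁿ e^{-nt}` (`n ≥ 1`) is `Γ(s)` times the
-- zeta function for `Re s > 1`. As `z ≠ 1`, both sides are continuous at `s = 1`, so they agree
-- there; the Mellin transform becomes `∫ F`, and `log(1 - z e^{-t})` is a primitive of `F`.
open Complex HurwitzZeta Filter Topology MeasureTheory Set Asymptotics in
theorem expZeta_one_eq_neg_log {x : ℝ} (hx : cexp (2 * Real.pi * I * x) ≠ 1) :
    expZeta x 1 = -Complex.log (1 - cexp (2 * Real.pi * I * x)) := by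
  set z := cexp (2 * Real.pi * I * x) with hzdef
  have hz : ‖z‖ = 1 := by
    rw [hzdef, show (2 * Real.pi * I * x : ℂ) = ((2 * Real.pi * x : ℝ) : ℂ) * I by push_cast; ring,
      norm_exp_ofReal_mul_I]
  let F : ℝ → ℂ := fun t => z * Real.exp (-t) / (1 - z * Real.exp (-t))
  have hne : ∀ t : ℝ, 0 ≤ t → 1 - z * Real.exp (-t) ≠ 0 := fun t ht =>
    slitPlane_ne_zero (one_sub_mul_exp_neg_mem_slitPlane hz hx ht)
  have hcont : ContinuousOn F (Ici 0) := by
    refine ContinuousOn.div (by fun_prop) (by fun_prop) fun t ht => hne t ht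
  have htop : F =O[atTop] fun t => Real.exp (-1 * t) := by
    refine IsBigO.of_bound 2 ?_
    filter_upwards [eventually_ge_atTop 1] with t ht
    have h1 : Real.exp (-t) ≤ 1 / 2 := by
      rw [Real.exp_neg, ← one_div]
      refine one_div_le_one_div_of_le (by norm_num) ?_
      linarith [Real.add_one_le_exp t]
    have h2 : ‖z * Real.exp (-t)‖ = Real.exp (-t) := by
      rw [norm_mul, hz, one_mul, norm_real, Real.norm_eq_abs, Real.abs_exp]
    have h3 : 1 / 2 ≤ ‖1 - z * Real.exp (-t)‖ := by
      have := norm_sub_norm_le 1 (z * Real.exp (-t))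
      rw [h2, norm_one] at this; linarith
    rw [norm_div, h2, Real.norm_eq_abs, Real.abs_exp, neg_one_mul, div_le_iff₀ (by linarith)]
    nlinarith [Real.exp_pos (-t)]
  have hbot : F =O[𝓝[>] 0] (fun t : ℝ => t ^ (-(0 : ℝ))) := by
    simp only [neg_zero, Real.rpow_zero]
    exact ((hcont 0 self_mem_Ici).mono Ioi_subset_Ici_self).isBigO_one ℝ
  have hloc : LocallyIntegrableOn F (Ioi 0) :=
    (hcont.mono Ioi_subset_Ici_self).locallyIntegrableOn measurableSet_Ioi
  have hmel : ∀ s : ℂ, 1 < s.re → mellin F s = Gamma s * expZeta x s := by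
    intro s hs
    have h1 := hasSum_mellin (a := fun n : ℕ => z ^ (n + 1)) (p := fun n => (n : ℝ) + 1) (F := F)
      (s := s) (fun n => Or.inr (by positivity)) (by linarith) (fun t ht => ?_) ?_
    · have h2 := (hasSum_expZeta_of_one_lt_re x hs).mul_left (Gamma s)
      rw [← hasSum_nat_add_iff' 1] at h2
      refine h1.unique ?_
      have hs0 : s ≠ 0 := by rintro rfl; simp at hs; linarith
      simp only [Finset.range_one, Finset.sum_singleton, Nat.cast_zero, zero_cpow hs0, div_zero,
        mul_zero, sub_zero] at h2
      refine h2.congr_fun fun n => ?_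
      rw [hzdef, ← Complex.exp_nat_mul, mul_div_assoc]
      push_cast
      ring_nf
    · have hr : ‖z * Real.exp (-t)‖ < 1 := by
        rw [norm_mul, hz, one_mul, norm_real, Real.norm_eq_abs, Real.abs_exp]
        rw [← Real.exp_zero]
        exact Real.exp_lt_exp.mpr (by simpa using ht)
      have := (hasSum_geometric_of_norm_lt_one hr).mul_left (z * Real.exp (-t))
      refine (this.congr_fun fun n => ?_ : HasSum _ _)
      rw [← pow_succ', mul_pow, ← ofReal_pow, ← Real.exp_nat_mul]
      congr 3; push_cast; ring
    · have := (summable_nat_add_iff 1).mpr (Real.summable_one_div_nat_rpow.mpr hs)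
      simpa [hz] using this
  have hd : DifferentiableAt ℂ (mellin F) 1 :=
    mellin_differentiableAt_of_isBigO_rpow_exp one_pos hloc htop hbot (by simp)
  have hx0 : (x : UnitAddCircle) ≠ 0 := by
    intro h
    obtain ⟨n, hn⟩ := (AddCircle.coe_eq_zero_iff (1 : ℝ)).mp h
    apply hx
    rw [hzdef, ← hn, Complex.exp_eq_one_iff]
    exact ⟨n, by simp; ring⟩
  have he : ContinuousAt (fun s => Gamma s * expZeta x s) 1 := by
    refine ContinuousAt.mul ?_ (differentiable_expZeta_of_ne_zero hx0 1).continuousAt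
    refine (differentiableAt_Gamma 1 fun m h => ?_).continuousAt
    have := congr_arg Complex.re h
    simp at this
    have : (0 : ℝ) ≤ m := by positivity
    linarith
  have heq : mellin F 1 = expZeta x 1 := by
    -- The point `1` lies on the boundary of the half-plane of absolute convergence, so the two
    -- limits from inside it can be compared.
    have hcl : (1 : ℂ) ∈ closure {s : ℂ | 1 < s.re} := by
      rw [closure_setOfPred_lt_re]; simp
    have : (𝓝[{s : ℂ | 1 < s.re}] (1 : ℂ)).NeBot := mem_closure_iff_nhdsWithin_neBot.mp hcl
    have h1 := hd.continuousAt.tendsto.mono_left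
      (nhdsWithin_le_nhds (s := {s : ℂ | 1 < s.re}))
    have h2 := he.tendsto.mono_left (nhdsWithin_le_nhds (s := {s : ℂ | 1 < s.re}))
    have h3 := tendsto_nhds_unique h1 (h2.congr' (eventually_nhdsWithin_of_forall
      fun s hs => (hmel s hs).symm))
    simpa using h3
  rw [← heq]
  have hmc : MellinConvergent F 1 :=
    mellinConvergent_of_isBigO_rpow_exp one_pos hloc htop hbot (by simp)
  have hint : IntegrableOn F (Ioi 0) := by
    simpa [MellinConvergent] using hmc
  have hderiv : ∀ t : ℝ, 0 ≤ t → HasDerivAt (fun t : ℝ => Complex.log (1 - z * Real.exp (-t)))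
      (F t) t := by
    intro t ht
    have h1 : HasDerivAt (fun t : ℝ => 1 - z * (Real.exp (-t) : ℂ)) (z * Real.exp (-t)) t := by
      have h0 : HasDerivAt (fun t : ℝ => Real.exp (-t)) (-Real.exp (-t)) t := by
        simpa using (hasDerivAt_neg t).exp
      simpa using (h0.ofReal_comp.const_mul z).const_sub 1
    exact h1.clog_real (one_sub_mul_exp_neg_mem_slitPlane hz hx ht)
  have hlim : Tendsto (fun t : ℝ => Complex.log (1 - z * Real.exp (-t))) atTop (𝓝 0) := by
    have h1 : Tendsto (fun t : ℝ => 1 - z * (Real.exp (-t) : ℂ)) atTop (𝓝 (1 - z * (0 : ℝ))) := by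
      refine tendsto_const_nhds.sub (tendsto_const_nhds.mul ?_)
      exact (continuous_ofReal.tendsto 0).comp Real.tendsto_exp_neg_atTop_nhds_zero
    simp only [ofReal_zero, mul_zero, sub_zero] at h1
    simpa using h1.clog (by simp)
  have := integral_Ioi_of_hasDerivAt_of_tendsto (hderiv 0 le_rfl).continuousAt.continuousWithinAt
    (fun t ht => hderiv t (le_of_lt ht)) hint hlim
  simpa [mellin] using this

-- The sawtooth series: `1 - e^{2πix} = 2 sin(πx) e^{i(πx - π/2)}` shows the argument, and `sinZeta`
-- at `1` is minus the imaginary part of the logarithm.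
open Complex HurwitzZeta in
theorem sinZeta_one {x : ℝ} (hx0 : 0 < x) (hx1 : x < 1) :
    sinZeta x 1 = Real.pi * (1 / 2 - x) := by
  have hpi := Real.pi_pos
  have hsin : 0 < Real.sin (Real.pi * x) := Real.sin_pos_of_pos_of_lt_pi (by positivity)
    (by nlinarith)
  have hpolar : 1 - cexp (2 * Real.pi * I * x) =
      ((2 * Real.sin (Real.pi * x) : ℝ) : ℂ) * cexp (((Real.pi * x - Real.pi / 2 : ℝ) : ℂ) * I) := by
    have h1 : ((2 * Real.sin (Real.pi * x) : ℝ) : ℂ) =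
        (cexp (-(Real.pi * x * I)) - cexp (Real.pi * x * I)) * I := by
      push_cast
      rw [Complex.sin, neg_mul]
      ring
    have h2 : cexp (((Real.pi * x - Real.pi / 2 : ℝ) : ℂ) * I) = cexp (Real.pi * x * I) * -I := by
      rw [← Complex.exp_neg_pi_div_two_mul_I, ← Complex.exp_add]
      congr 1; push_cast; ring
    have h3 : cexp (2 * Real.pi * I * x) = cexp (Real.pi * x * I) * cexp (Real.pi * x * I) := by
      rw [← Complex.exp_add]; congr 1; ring
    have h4 : cexp (-(Real.pi * x * I)) * cexp (Real.pi * x * I) = 1 := by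
      rw [← Complex.exp_add]; simp
    rw [h1, h2, h3]
    linear_combination (-1 : ℂ) * h4 +
      (cexp (-(Real.pi * x * I)) - cexp (Real.pi * x * I)) * cexp (Real.pi * x * I) * I_sq
  have harg : (1 - cexp (2 * Real.pi * I * x)).arg = Real.pi * x - Real.pi / 2 := by
    rw [hpolar, arg_real_mul _ (by positivity), arg_exp_mul_I, toIocMod_eq_self]
    constructor <;> nlinarith
  have hne : cexp (2 * Real.pi * I * x) ≠ 1 := fun h => by
    rw [h, sub_self] at hpolar
    have := mul_eq_zero.mp hpolar.symm
    simp only [Complex.exp_ne_zero, or_false, ofReal_eq_zero] at this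
    linarith
  have hconj : cexp (2 * Real.pi * I * ((-x : ℝ) : ℂ)) =
      (starRingEnd ℂ) (cexp (2 * Real.pi * I * x)) := by
    rw [← Complex.exp_conj]
    simp [map_ofNat]
  have hne' : cexp (2 * Real.pi * I * ((-x : ℝ) : ℂ)) ≠ 1 := fun h => hne <| by
    rw [hconj] at h
    simpa using congr_arg (starRingEnd ℂ) h
  have hlog : Complex.log (1 - cexp (2 * Real.pi * I * ((-x : ℝ) : ℂ))) =
      (starRingEnd ℂ) (Complex.log (1 - cexp (2 * Real.pi * I * x))) := by
    rw [hconj, ← Complex.log_conj _ (by rw [harg]; nlinarith)]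
    simp
  rw [sinZeta_eq, expZeta_one_eq_neg_log hne]
  have hneg : expZeta (-(x : UnitAddCircle)) 1 = expZeta ((-x : ℝ) : UnitAddCircle) 1 := by simp
  rw [hneg, expZeta_one_eq_neg_log hne', hlog]
  have him : (Complex.log (1 - cexp (2 * Real.pi * I * x))).im = Real.pi * x - Real.pi / 2 := by
    rw [log_im, harg]
  rw [show ∀ w : ℂ, (-w - -(starRingEnd ℂ) w) / (2 * I) = -(w.im : ℂ) by
    intro w
    have := Complex.sub_conj w
    push_cast at this
    field_simp
    linear_combination -this, him]
  push_cast
  ring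

-- Even `m` selects the cosine zeta function and odd `m` the sine one. The case `m = 1` uses
-- `sinZeta_one`; at `x = 0` oddness gives `0`, in accordance with the convention `B̄₁(0) = 0`.
open HurwitzZeta in
theorem expZeta_add_neg {m : ℕ} (hm : 1 ≤ m) {x : ℝ} (hx0 : 0 ≤ x) (hx1 : x < 1) :
    expZeta x m + (-1) ^ m * expZeta (-(x : UnitAddCircle)) m =
      -(2 * Real.pi * Complex.I) ^ m / m.factorial * bernoulliBar m x := by
  have hcast : ∀ k : ℕ, ((Polynomial.bernoulli k).map (algebraMap ℚ ℂ)).eval (x : ℂ) =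
      (bernoulliFun k x : ℂ) := fun k => by
    have : (Polynomial.bernoulli k).map (algebraMap ℚ ℂ) = _ :=
      (Polynomial.map_map (algebraMap ℚ ℝ) Complex.ofRealHom _).symm
    rw [this, Polynomial.eval_map, bernoulliFun]
    exact Polynomial.eval₂_at_apply Complex.ofRealHom x
  have hmem : x ∈ Set.Icc (0 : ℝ) 1 := ⟨hx0, hx1.le⟩
  rw [expZeta, expZeta, cosZeta_neg, sinZeta_neg]
  rcases Nat.even_or_odd' m with ⟨k, rfl | rfl⟩
  · have h := cosZeta_two_mul_nat (k := k) (by omega) hmem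
    rw [bernoulliBar_eq_add_ite hx0 hx1, if_neg (by omega), add_zero]
    rw [hcast] at h
    push_cast
    rw [h, pow_mul (-1 : ℂ), mul_pow _ Complex.I, pow_mul Complex.I, Complex.I_sq]
    norm_num
    ring
  · have hs : sinZeta x ((2 * k + 1 : ℕ) : ℂ) = (-1) ^ (k + 1) * (2 * Real.pi) ^ (2 * k + 1) / 2 /
        (2 * k + 1).factorial * bernoulliBar (2 * k + 1) x := by
      rcases Nat.eq_zero_or_pos k with rfl | hk
      · rcases eq_or_lt_of_le hx0 with rfl | hx0'
        · have : sinZeta ((0 : ℝ) : UnitAddCircle) ((2 * 0 + 1 : ℕ) : ℂ) = 0 := by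
            have := sinZeta_neg (0 : UnitAddCircle) ((2 * 0 + 1 : ℕ) : ℂ)
            rw [neg_zero] at this
            simpa using self_eq_neg.mp this
          rw [this]
          simp [bernoulliBar]
        · rw [bernoulliBar_eq_add_ite hx0 hx1, if_neg hx0'.ne']
          have := sinZeta_one hx0' hx1
          simp only [mul_zero, zero_add, Nat.cast_one, this]
          simp
          ring
      · have h := sinZeta_two_mul_nat_add_one (k := k) (by omega) hmem
        rw [bernoulliBar_eq_add_ite hx0 hx1, if_neg (by omega), add_zero]
        rw [hcast] at h
        push_cast
        rw [h]
    rw [hs, mul_pow _ Complex.I, pow_succ Complex.I, pow_mul Complex.I, Complex.I_sq,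
      pow_succ (-1 : ℂ) (2 * k), pow_mul (-1 : ℂ)]
    norm_num
    ring

/-! ### Dirichlet `L`-values as character sums of Bernoulli functions. -/

section Characters

variable {q : ℕ} [NeZero q]

/-- The function `j ↦ B̄ₘ(a j / q)` on `ℤ / q ℤ`. -/
noncomputable def bernoulliZMod (q m a : ℕ) (j : ZMod q) : ℂ :=
  bernoulliBar m (a * ((j.val : ℝ) / q))

theorem bernoulliZMod_natCast (m a k : ℕ) :
    bernoulliZMod q m a (k : ZMod q) = bernoulliBar m (a * ((k : ℝ) / q)) := by
  have hq : (q : ℝ) ≠ 0 := by exact_mod_cast NeZero.ne q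
  have hf : Function.Periodic (fun i : ℤ => bernoulliBar m (a * ((i : ℝ) / q))) q := fun i => by
    show bernoulliBar m (a * (((i + (q : ℤ) : ℤ) : ℝ) / q)) = bernoulliBar m (a * ((i : ℝ) / q))
    rw [← bernoulliBar_add_int m (a * ((i : ℝ) / q)) a]
    congr 1; push_cast; field_simp
  have := hf.apply_zmod_val k
  rw [bernoulliZMod]
  exact_mod_cast this

theorem bernoulliZMod_neg (m a : ℕ) (j : ZMod q) :
    bernoulliZMod q m a (-j) = (-1) ^ m * bernoulliZMod q m a j := by
  have hq : (q : ℝ) ≠ 0 := by exact_mod_cast NeZero.ne q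
  have h1 : (-j : ZMod q) = ((q - j.val : ℕ) : ZMod q) := by
    rw [Nat.cast_sub j.val_lt.le]; simp
  rw [h1, bernoulliZMod_natCast, Nat.cast_sub j.val_lt.le, bernoulliZMod]
  rw [show (a : ℝ) * (((q : ℝ) - j.val) / q) = -(a * ((j.val : ℝ) / q)) + (a : ℤ) by
    push_cast; field_simp; ring, bernoulliBar_add_int, bernoulliBar_neg]
  push_cast; rfl

theorem bernoulliZMod_mul {a : ℕ} (ha : a.Coprime q) (m : ℕ) (j : ZMod q) :
    bernoulliZMod q m 1 ((ZMod.unitOfCoprime a ha : ZMod q) * j) = bernoulliZMod q m a j := by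
  have h : (ZMod.unitOfCoprime a ha : ZMod q) * j = ((a * j.val : ℕ) : ZMod q) := by simp
  rw [h, bernoulliZMod_natCast, bernoulliZMod]
  congr 2; push_cast; ring

-- Write `χ` as the Fourier transform of `Φ`; then `L(m, χ) = ∑ Φ(j) expZeta(-j/q, m)`. `Φ` has the
-- parity of `χ`, so averaging over `j` and `-j` produces the combination evaluated by
-- `expZeta_add_neg`.
open scoped ZMod in
theorem LFunction_eq_sum_bernoulliZMod {m : ℕ} (hm : 1 ≤ m) {χ : DirichletCharacter ℂ q}
    (hχ : χ (-1) = (-1) ^ m) :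
    DirichletCharacter.LFunction χ m = -(2 * Real.pi * Complex.I) ^ m / (2 * m.factorial * q) *
      ∑ k : ZMod q, χ k * 𝓕 (bernoulliZMod q m 1) k := by
  have hq : (q : ℂ) ≠ 0 := by exact_mod_cast NeZero.ne q
  set Φ : ZMod q → ℂ := 𝓕⁻ (fun k => χ k) with hΦ
  have hΦF : 𝓕 Φ = fun k => χ k := LinearEquiv.apply_symm_apply _ _
  have hs : ((-1 : ℂ) ^ m) * (-1) ^ m = 1 := by rw [← mul_pow]; simp
  have hneg : ∀ j, Φ (-j) = (-1) ^ m * Φ j := fun j => by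
    rw [hΦ, ZMod.invDFT_apply, ZMod.invDFT_apply, ← Equiv.sum_comp (Equiv.neg _)]
    simp only [Equiv.neg_apply, neg_mul_neg, smul_eq_mul, Finset.mul_sum]
    refine Finset.sum_congr rfl fun k _ => ?_
    rw [← neg_one_mul k, map_mul χ, hχ]; ring
  -- The term `j = 0` involves the Riemann zeta function, with its pole at `1`; for `m = 1` the
  -- function `Φ` is odd and kills it.
  have h0 : Φ 0 = 0 ∨ (m : ℂ) ≠ 1 := by
    by_cases h : m = 1
    · left
      have := hneg 0
      rw [h, neg_zero, pow_one, neg_one_mul] at this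
      exact self_eq_neg.mp this
    · right; exact_mod_cast h
  have hE : ∀ j : ZMod q, HurwitzZeta.expZeta (ZMod.toAddCircle j) m +
      (-1) ^ m * HurwitzZeta.expZeta (ZMod.toAddCircle (-j)) m =
      -(2 * Real.pi * Complex.I) ^ m / m.factorial * bernoulliZMod q m 1 j := fun j => by
    have hq0 : (0 : ℝ) < q := by exact_mod_cast Nat.pos_of_ne_zero (NeZero.ne q)
    rw [map_neg, ZMod.toAddCircle_apply, expZeta_add_neg hm (by positivity)
      ((div_lt_one hq0).mpr (by exact_mod_cast j.val_lt)), bernoulliZMod]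
    simp
  have h1 : DirichletCharacter.LFunction χ m =
      ∑ j : ZMod q, Φ j * HurwitzZeta.expZeta (ZMod.toAddCircle (-j)) m := by
    rw [← ZMod.LFunction_dft Φ h0, hΦF]; rfl
  have h2 : DirichletCharacter.LFunction χ m =
      ∑ j : ZMod q, Φ (-j) * HurwitzZeta.expZeta (ZMod.toAddCircle j) m := by
    rw [h1, ← Equiv.sum_comp (Equiv.neg _)]; simp
  have h3 : 2 * DirichletCharacter.LFunction χ m = ∑ j : ZMod q, Φ (-j) *
      (-(2 * Real.pi * Complex.I) ^ m / m.factorial * bernoulliZMod q m 1 j) := by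
    rw [two_mul]
    nth_rewrite 1 [h2]
    rw [h1, ← Finset.sum_add_distrib]
    refine Finset.sum_congr rfl fun j _ => ?_
    rw [← hE, hneg]
    linear_combination -Φ j * HurwitzZeta.expZeta (ZMod.toAddCircle (-j)) m * hs
  have h4 : ∑ j : ZMod q, Φ (-j) *
      (-(2 * Real.pi * Complex.I) ^ m / m.factorial * bernoulliZMod q m 1 j) =
      -(2 * Real.pi * Complex.I) ^ m / (m.factorial * q) *
      ∑ k : ZMod q, χ k * 𝓕 (bernoulliZMod q m 1) k := by
    simp only [hΦ, ZMod.invDFT_apply, ZMod.dft_apply, smul_eq_mul, Finset.mul_sum, Finset.sum_mul]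
    rw [Finset.sum_comm]
    refine Finset.sum_congr rfl fun k _ => Finset.sum_congr rfl fun j _ => ?_
    rw [mul_neg, mul_comm k j]
    field_simp
  have h5 : DirichletCharacter.LFunction χ m = 2⁻¹ * (2 * DirichletCharacter.LFunction χ m) := by
    ring
  rw [h5, h3, h4]
  field_simp

open scoped ZMod in
theorem dft_bernoulliZMod_neg (m a : ℕ) (k : ZMod q) :
    𝓕 (bernoulliZMod q m a) (-k) = (-1) ^ m * 𝓕 (bernoulliZMod q m a) k := by
  simp only [ZMod.dft_apply, smul_eq_mul, Finset.mul_sum]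
  rw [← Equiv.sum_comp (Equiv.neg _)]
  refine Finset.sum_congr rfl fun j _ => ?_
  simp only [Equiv.neg_apply, neg_mul_neg, bernoulliZMod_neg]
  ring

-- The substitution `k ↦ ak` moves the factor `χ(a)` into the argument of the Bernoulli function.
open scoped ZMod in
theorem apply_mul_LFunction_eq {m : ℕ} (hm : 1 ≤ m) {χ : DirichletCharacter ℂ q}
    (hχ : χ (-1) = (-1) ^ m) {a : ℕ} (ha : a.Coprime q) :
    χ (a : ZMod q) * DirichletCharacter.LFunction χ m =
      -(2 * Real.pi * Complex.I) ^ m / (2 * m.factorial * q) *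
      ∑ k : ZMod q, χ k * 𝓕 (bernoulliZMod q m a) k := by
  set u := ZMod.unitOfCoprime a ha
  have hu : (u : ZMod q) = a := ZMod.coe_unitOfCoprime a ha
  have h1 : bernoulliZMod q m a = fun j => bernoulliZMod q m 1 ((u : ZMod q) * j) :=
    funext fun j => (bernoulliZMod_mul ha m j).symm
  have h2 : ∀ k, 𝓕 (bernoulliZMod q m a) ((u : ZMod q) * k) = 𝓕 (bernoulliZMod q m 1) k := by
    intro k
    have := ZMod.dft_comp_unitMul (bernoulliZMod q m 1) u ((u : ZMod q) * k)
    rw [h1, this]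
    simp
  rw [LFunction_eq_sum_bernoulliZMod hm hχ,
    ← Equiv.sum_comp (Units.mulLeft u) fun k => χ k * 𝓕 (bernoulliZMod q m a) k]
  simp only [Units.mulLeft_apply, h2, map_mul, Finset.mul_sum]
  exact Finset.sum_congr rfl fun k _ => by rw [hu]; ring

-- The substitution `k ↦ -k` multiplies the sum by `χ(-1)(-1)^m ≠ 1`. This allows the parity
-- conditions to be removed from the sum over characters.
open scoped ZMod in
theorem sum_mul_dft_bernoulliZMod_eq_zero {m : ℕ} {χ : DirichletCharacter ℂ q}
    (hχ : χ (-1) ≠ (-1) ^ m) (a : ℕ) :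
    ∑ k : ZMod q, χ k * 𝓕 (bernoulliZMod q m a) k = 0 := by
  set S := ∑ k : ZMod q, χ k * 𝓕 (bernoulliZMod q m a) k with hS
  have h1 : S = χ (-1) * (-1) ^ m * S := by
    conv_lhs => rw [hS, ← Equiv.sum_comp (Equiv.neg _)]
    rw [hS, Finset.mul_sum]
    refine Finset.sum_congr rfl fun k _ => ?_
    rw [Equiv.neg_apply, dft_bernoulliZMod_neg, ← neg_one_mul k, map_mul]
    ring
  have hs : ((-1 : ℂ) ^ m) * (-1) ^ m = 1 := by rw [← mul_pow]; simp
  by_contra h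
  apply hχ
  have h2 : χ (-1) * (-1) ^ m = 1 := by
    have : (χ (-1) * (-1) ^ m - 1) * S = 0 := by linear_combination -h1
    linear_combination (mul_eq_zero.mp this).resolve_right h
  linear_combination (-1 : ℂ) ^ m * h2 - χ (-1) * hs

end Characters

/-! ### Möbius sums over divisors. -/

section MoebiusSums

theorem sum_divisors_moebius_eq_ite (n : ℕ) :
    ∑ e ∈ n.divisors, ArithmeticFunction.moebius e = if n = 1 then 1 else 0 := by
  rw [← ArithmeticFunction.coe_mul_zeta_apply, ArithmeticFunction.moebius_mul_coe_zeta,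
    ArithmeticFunction.one_apply]

theorem sum_divisors_moebius_div_eq_zero {q : ℕ} (hq : 2 ≤ q) :
    ∑ d ∈ q.divisors, (ArithmeticFunction.moebius (q / d) : ℝ) = 0 := by
  rw [Nat.sum_div_divisors q fun d => (ArithmeticFunction.moebius d : ℝ)]
  have := sum_divisors_moebius_eq_ite q
  rw [if_neg (by omega)] at this
  exact_mod_cast this

/-- The Euler product is available for squarefree numbers, so it is taken over the radical `r` of
`q`; divisors of `q` that do not divide `r` are not squarefree and contribute nothing. -/
theorem sum_divisors_moebius_div_mul_pow {q : ℕ} (hq : q ≠ 0) (k : ℕ) :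
    ∑ d ∈ q.divisors, (ArithmeticFunction.moebius (q / d) : ℝ) * (d : ℝ) ^ k = jordanJ k q := by
  have hq' : (q : ℝ) ≠ 0 := by exact_mod_cast hq
  set r := ∏ p ∈ q.primeFactors, p with hr
  have hpr : ∀ p ∈ q.primeFactors, p.Prime := fun p hp => Nat.prime_of_mem_primeFactors hp
  have hrp : r.primeFactors = q.primeFactors := Nat.primeFactors_prod hpr
  have hr0 : r ≠ 0 := Finset.prod_ne_zero_iff.mpr fun p hp => (hpr p hp).ne_zero
  have hrq : r ∣ q := Nat.prod_primeFactors_dvd q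
  have hrs : Squarefree r := by
    rw [hr]
    refine Finset.squarefree_prod_of_pairwise_isCoprime (fun p hp p' hp' hne => ?_)
      fun p hp => (hpr p hp).squarefree
    exact Nat.coprime_iff_isRelPrime.mp ((Nat.coprime_primes (hpr p hp) (hpr p' hp')).mpr hne)
  let f : ArithmeticFunction ℝ := ⟨fun n => if n = 0 then 0 else 1 / (n : ℝ) ^ k, by simp⟩
  have hf : f.IsMultiplicative := by
    refine ArithmeticFunction.IsMultiplicative.iff_ne_zero.mpr ⟨by simp [f], ?_⟩
    intro m n hm hn _
    simp [f, hm, hn, mul_pow, mul_comm]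
  have key := hf.prodPrimeFactors_one_sub_of_squarefree (n := r) f hrs
  rw [hrp] at key
  have h1 : ∏ p ∈ q.primeFactors, (1 - 1 / (p : ℝ) ^ k) = ∏ p ∈ q.primeFactors, (1 - f p) :=
    Finset.prod_congr rfl fun p hp => by simp [f, (hpr p hp).ne_zero]
  have h2 : ∑ d ∈ r.divisors, (ArithmeticFunction.moebius d : ℝ) * f d =
      ∑ d ∈ q.divisors, (ArithmeticFunction.moebius d : ℝ) * f d := by
    refine Finset.sum_subset (Nat.divisors_subset_of_dvd hq hrq) fun e he her => ?_
    rw [ArithmeticFunction.moebius_eq_zero_of_not_squarefree, Int.cast_zero, zero_mul]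
    intro hs
    refine her (Nat.mem_divisors.mpr ⟨?_, hr0⟩)
    rw [← Nat.prod_primeFactors_of_squarefree hs, hr]
    exact Finset.prod_dvd_prod_of_subset _ _ _
      (Nat.primeFactors_mono (Nat.dvd_of_mem_divisors he) hq)
  rw [jordanJ, h1, key, h2, Finset.mul_sum,
    ← Nat.sum_div_divisors q fun d => (q : ℝ) ^ k * ((ArithmeticFunction.moebius d : ℝ) * f d)]
  refine Finset.sum_congr rfl fun d hd => ?_
  have hd0 : d ≠ 0 := (Nat.pos_of_mem_divisors hd).ne'
  have hdvd := Nat.dvd_of_mem_divisors hd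
  have hqd : q / d ≠ 0 := (Nat.div_pos (Nat.le_of_dvd (Nat.pos_of_ne_zero hq) hdvd)
    (Nat.pos_of_ne_zero hd0)).ne'
  have hd' : (d : ℝ) ≠ 0 := by exact_mod_cast hd0
  have : f (q / d) = (d : ℝ) ^ k / (q : ℝ) ^ k := by
    show (if q / d = 0 then 0 else 1 / ((q / d : ℕ) : ℝ) ^ k) = _
    rw [if_neg hqd, Nat.cast_div hdvd hd', div_pow, one_div_div]
  rw [this]
  field_simp

/-- The indicator of the units is `∑ μ(e)` over `e ∣ gcd(s, q)`; with `e = q/d`, the multiples of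
`e` modulo `q` are the `te` with `t < d`. -/
theorem sum_ite_isUnit_eq_sum_divisors (q : ℕ) [NeZero q] (F : ZMod q → ℂ) :
    ∑ k : ZMod q, (open Classical in if IsUnit k then F k else 0) =
      ∑ d ∈ q.divisors, (ArithmeticFunction.moebius (q / d) : ℂ) *
        ∑ t ∈ Finset.range d, F ((t * (q / d) : ℕ) : ZMod q) := by
  classical
  have hq : q ≠ 0 := NeZero.ne q
  have h1 : ∀ s : ℕ, (if IsUnit (s : ZMod q) then F s else 0) =
      ∑ e ∈ q.divisors, (ArithmeticFunction.moebius e : ℂ) * if e ∣ s then F s else 0 := by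
    intro s
    have hd : q.divisors.filter (· ∣ s) = (s.gcd q).divisors := by
      ext e
      simp only [Finset.mem_filter, Nat.mem_divisors, Nat.dvd_gcd_iff]
      have : s.gcd q ≠ 0 := Nat.gcd_ne_zero_right hq
      tauto
    simp only [mul_ite, mul_zero]
    rw [← Finset.sum_filter, hd, ← Finset.sum_mul, ← Int.cast_sum, sum_divisors_moebius_eq_ite]
    simp only [ZMod.isUnit_iff_coprime, Nat.Coprime]
    split_ifs <;> simp
  have h2 : ∑ k : ZMod q, (if IsUnit k then F k else 0) =
      ∑ s ∈ Finset.range q, if IsUnit (s : ZMod q) then F s else 0 := by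
    rw [← sum_zmod_val_eq_sum_range]
    simp
  rw [h2, Finset.sum_congr rfl fun s _ => h1 s, Finset.sum_comm,
    ← Nat.sum_div_divisors q fun e => ∑ s ∈ Finset.range q,
      (ArithmeticFunction.moebius e : ℂ) * if e ∣ s then F s else 0]
  refine Finset.sum_congr rfl fun d hd => ?_
  rw [← Finset.mul_sum]
  congr 1
  have hdvd := Nat.dvd_of_mem_divisors hd
  set e := q / d with he
  have hqe : q = d * e := (Nat.mul_div_cancel' hdvd).symm
  have he0 : 0 < e := Nat.pos_of_ne_zero fun h => hq (by rw [hqe, h, mul_zero])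
  conv_lhs => rw [show Finset.range q = Finset.range (d * e) by rw [← hqe]]
  rw [Finset.sum_range_mul_comm_div]
  refine Finset.sum_congr rfl fun t _ => ?_
  rw [Finset.sum_eq_single_of_mem 0 (Finset.mem_range.mpr he0)]
  · simp
  · intro i hi hi0
    rw [if_neg]
    rw [Nat.dvd_add_right (Dvd.intro_left t rfl)]
    exact Nat.not_dvd_of_pos_of_lt (Nat.pos_of_ne_zero hi0) (Finset.mem_range.mp hi)

end MoebiusSums

/-! ### Lowering the level, and the triple convolution. -/

section Level

open scoped ZMod

/-- Write the summation index as `id + r`. At a multiple of `e` the additive character depends only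
on `r`, and the sum over `i` is a Raabe sum because `a` is prime to `e`. -/
theorem dft_bernoulliZMod_mul {q d e : ℕ} [NeZero q] [NeZero d] (hq : q = d * e) {a : ℕ}
    (ha : a.Coprime e) (m t : ℕ) :
    𝓕 (bernoulliZMod q m a) ((t * e : ℕ) : ZMod q) =
      e / (e : ℂ) ^ m * 𝓕 (bernoulliZMod d m a) (t : ZMod d) := by
  have hd0 : (d : ℝ) ≠ 0 := by exact_mod_cast NeZero.ne d
  have he : e ≠ 0 := by rintro rfl; exact NeZero.ne q (by simpa using hq)
  have he0 : (e : ℝ) ≠ 0 := by exact_mod_cast he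
  have hsum : ∀ (N : ℕ) [NeZero N] (f : ZMod N → ℂ),
      ∑ x, f x = ∑ i ∈ Finset.range N, f (i : ZMod N) := fun N _ f => by
    rw [← sum_zmod_val_eq_sum_range]; simp
  rw [ZMod.dft_apply, ZMod.dft_apply, hsum, hsum, show Finset.range q = Finset.range (e * d) by
    rw [hq, mul_comm], Finset.sum_range_mul_comm_div, Finset.sum_comm, Finset.mul_sum]
  refine Finset.sum_congr rfl fun r _ => ?_
  have hchar : ∀ i : ℕ, ZMod.stdAddChar (-(((i * d + r : ℕ) : ZMod q) * ((t * e : ℕ) : ZMod q))) =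
      ZMod.stdAddChar (-((r : ZMod d) * (t : ZMod d))) := by
    intro i
    have h1 := ZMod.stdAddChar_coe (N := q) (-(((i * d + r) * (t * e) : ℕ) : ℤ))
    have h2 := ZMod.stdAddChar_coe (N := d) (-((r * t : ℕ) : ℤ))
    push_cast at h1 h2 ⊢
    rw [h1, h2, Complex.exp_eq_exp_iff_exists_int]
    refine ⟨-(i * t), ?_⟩
    have hd1 : (d : ℂ) ≠ 0 := by exact_mod_cast NeZero.ne d
    have he1 : (e : ℂ) ≠ 0 := by exact_mod_cast he
    rw [hq]; push_cast
    field_simp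
    ring
  have hbar : ∑ i ∈ Finset.range e, bernoulliBar m (a * (((i * d + r : ℕ) : ℝ) / q)) =
      e / (e : ℝ) ^ m * bernoulliBar m (a * ((r : ℝ) / d)) := by
    have := sum_bernoulliBar_add_mul_div_of_coprime m he ha (a * r / (d * e))
    rw [show (e : ℝ) * (a * r / (d * e)) = a * (r / d) by field_simp] at this
    rw [← this]
    refine Finset.sum_congr rfl fun i _ => ?_
    congr 1
    rw [hq]; push_cast; field_simp; ring
  simp only [hchar, smul_eq_mul, bernoulliZMod_natCast, ← Finset.mul_sum]
  have hbar' := congr_arg (fun x : ℝ => (x : ℂ)) hbar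
  push_cast at hbar' ⊢
  rw [hbar']
  ring

/-- Orthogonality of additive characters forces the three indices to sum to `0`. -/
theorem sum_dft_mul_dft_mul_dft {N : ℕ} [NeZero N] (f g h : ZMod N → ℂ) :
    ∑ t, 𝓕 f t * 𝓕 g t * 𝓕 h t = N * ∑ r, f r * ∑ s, g s * h (-(s + r)) := by
  have horth : ∀ x : ZMod N, ∑ t : ZMod N, ZMod.stdAddChar (t * x) =
      if x = 0 then (N : ℂ) else 0 := fun x => by
    rw [AddChar.sum_mulShift x (ZMod.isPrimitive_stdAddChar N)]
    simp
  have h1 : ∀ t : ZMod N, 𝓕 f t * 𝓕 g t * 𝓕 h t =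
      ∑ r, ∑ s, ∑ x, f r * (g s * h x) * ZMod.stdAddChar (t * -(r + s + x)) := by
    intro t
    simp only [ZMod.dft_apply, smul_eq_mul]
    rw [Finset.sum_mul_sum, Finset.sum_mul]
    refine Finset.sum_congr rfl fun r _ => ?_
    rw [Finset.sum_mul_sum]
    refine Finset.sum_congr rfl fun s _ => Finset.sum_congr rfl fun x _ => ?_
    rw [show t * -(r + s + x) = -(r * t) + -(s * t) + -(x * t) by ring, AddChar.map_add_eq_mul,
      AddChar.map_add_eq_mul]
    ring
  simp only [h1]
  rw [Finset.sum_comm, Finset.mul_sum]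
  refine Finset.sum_congr rfl fun r _ => ?_
  rw [Finset.sum_comm, Finset.mul_sum, Finset.mul_sum]
  refine Finset.sum_congr rfl fun s _ => ?_
  rw [Finset.sum_comm]
  simp only [← Finset.mul_sum, horth]
  rw [Finset.sum_eq_single (-(s + r))]
  · rw [if_pos (by ring)]; ring
  · intro x _ hx
    rw [if_neg, mul_zero]
    intro h0
    apply hx
    linear_combination -h0
  · intro h; exact absurd (Finset.mem_univ _) h

theorem sum_dft_bernoulliZMod {d : ℕ} [NeZero d] (m₁ m₂ m₃ a b c : ℕ) :
    ∑ t : ZMod d, 𝓕 (bernoulliZMod d m₁ a) t * 𝓕 (bernoulliZMod d m₂ b) t *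
      𝓕 (bernoulliZMod d m₃ c) t = d * (-1) ^ m₃ * (tripleDedekindSum m₁ m₂ m₃ a b c d : ℂ) := by
  have hsum : ∀ f : ZMod d → ℂ, ∑ x, f x = ∑ i ∈ Finset.range d, f (i : ZMod d) := fun f => by
    rw [← sum_zmod_val_eq_sum_range]; simp
  rw [sum_dft_mul_dft_mul_dft, hsum, mul_assoc, tripleDedekindSum]
  congr 1
  simp only [hsum, bernoulliZMod_neg]
  push_cast
  rw [Finset.mul_sum]
  refine Finset.sum_congr rfl fun r _ => ?_
  rw [bernoulliZMod_natCast, mul_left_comm]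
  congr 1
  rw [Finset.mul_sum]
  refine Finset.sum_congr rfl fun s _ => ?_
  have : ((s : ZMod d) + r) = ((s + r : ℕ) : ZMod d) := by push_cast; rfl
  rw [this, bernoulliZMod_natCast, bernoulliZMod_natCast]
  push_cast
  rw [add_div]
  ring

end Level

/-! ### Orthogonality of Dirichlet characters. -/

section Orthogonality

variable {q : ℕ} [NeZero q]

open Classical in
theorem sum_inv_apply_mul_sum_apply_mul (G : ZMod q → ℂ) (k : ZMod q) :
    ∑ χ : DirichletCharacter ℂ q, χ⁻¹ k * ∑ j, χ j * G j =
      if IsUnit k then (q.totient : ℂ) * G k else 0 := by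
  by_cases hk : IsUnit k
  · rw [if_pos hk]
    have hinv : ∀ χ : DirichletCharacter ℂ q, χ⁻¹ k = χ k⁻¹ := fun χ => by
      obtain ⟨u, rfl⟩ := hk
      rw [MulChar.inv_apply, Ring.inverse_unit, ZMod.inv_coe_unit]
    simp only [hinv, Finset.mul_sum]
    rw [Finset.sum_comm]
    simp only [← mul_assoc, ← Finset.sum_mul, DirichletCharacter.sum_char_inv_mul_char_eq ℂ hk]
    simp
  · rw [if_neg hk]
    exact Finset.sum_eq_zero fun χ _ => by rw [MulChar.map_nonunit _ hk, zero_mul]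

open Classical in
-- `(χ₁χ₂)⁻¹(k)` splits as `χ₁⁻¹(k) χ₂⁻¹(k)`, so for fixed `k` the two character sums separate and
-- each one selects the same unit `k`.
theorem sum_sum_characters_eq (G₁ G₂ G₃ : ZMod q → ℂ) :
    ∑ χ₁ : DirichletCharacter ℂ q, ∑ χ₂ : DirichletCharacter ℂ q,
      (∑ k, χ₁ k * G₁ k) * (∑ k, χ₂ k * G₂ k) * ∑ k, (χ₁ * χ₂)⁻¹ k * G₃ k =
      (q.totient : ℂ) ^ 2 * ∑ k, if IsUnit k then G₁ k * G₂ k * G₃ k else 0 := by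
  have h : ∀ χ₁ χ₂ : DirichletCharacter ℂ q,
      (∑ k, χ₁ k * G₁ k) * (∑ k, χ₂ k * G₂ k) * ∑ k, (χ₁ * χ₂)⁻¹ k * G₃ k =
      ∑ k, G₃ k * ((χ₁⁻¹ k * ∑ j, χ₁ j * G₁ j) * (χ₂⁻¹ k * ∑ j, χ₂ j * G₂ j)) := by
    intro χ₁ χ₂
    rw [Finset.mul_sum]
    refine Finset.sum_congr rfl fun k _ => ?_
    rw [mul_inv, MulChar.mul_apply]
    ring
  simp only [h]
  rw [Finset.sum_congr rfl fun χ₁ _ => Finset.sum_comm, Finset.sum_comm, Finset.mul_sum]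
  refine Finset.sum_congr rfl fun k _ => ?_
  simp only [← Finset.mul_sum]
  rw [← Finset.sum_mul, sum_inv_apply_mul_sum_apply_mul, sum_inv_apply_mul_sum_apply_mul]
  split_ifs <;> ring

end Orthogonality

/-! ### Assembly of the mean value formula. -/

open scoped ZMod in
theorem tripleMean_eq_sum_characters {q m₁ m₂ m₃ a b c : ℕ} [NeZero q] (hm₁ : 1 ≤ m₁)
    (hm₂ : 1 ≤ m₂) (hm₃ : 1 ≤ m₃) (hpar : m₁ + m₂ ≡ m₃ [MOD 2])
    (haq : a.Coprime q) (hbq : b.Coprime q) (hcq : c.Coprime q) :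
    tripleMean q m₁ m₂ m₃ a b c =
      -((2 * Real.pi * Complex.I) ^ (m₁ + m₂ + m₃) /
        (8 * m₁.factorial * m₂.factorial * m₃.factorial * (q : ℂ) ^ 3)) *
      ∑ χ₁ : DirichletCharacter ℂ q, ∑ χ₂ : DirichletCharacter ℂ q,
        (∑ k, χ₁ k * 𝓕 (bernoulliZMod q m₁ a) k) * (∑ k, χ₂ k * 𝓕 (bernoulliZMod q m₂ b) k) *
          ∑ k, (χ₁ * χ₂)⁻¹ k * 𝓕 (bernoulliZMod q m₃ c) k := by
  rw [tripleMean, Finset.sum_filter, Finset.mul_sum]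
  refine Finset.sum_congr rfl fun χ₁ _ => ?_
  split_ifs with h₁
  · rw [Finset.sum_filter, Finset.mul_sum]
    refine Finset.sum_congr rfl fun χ₂ _ => ?_
    split_ifs with h₂
    · have h₃ : (χ₁ * χ₂)⁻¹ (-1) = (-1) ^ m₃ := by
        rw [MulChar.inv_apply_eq_inv', MulChar.mul_apply, h₁, h₂, ← pow_add,
          neg_one_pow_eq_pow_mod_two, hpar, ← neg_one_pow_eq_pow_mod_two, ← inv_pow]
        norm_num
      have e₁ := apply_mul_LFunction_eq hm₁ h₁ haq
      have e₂ := apply_mul_LFunction_eq hm₂ h₂ hbq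
      have e₃ := apply_mul_LFunction_eq hm₃ h₃ hcq
      rw [MulChar.star_eq_inv]
      calc _ = (χ₁ (a : ZMod q) * DirichletCharacter.LFunction χ₁ m₁) *
            (χ₂ (b : ZMod q) * DirichletCharacter.LFunction χ₂ m₂) *
            ((χ₁ * χ₂)⁻¹ (c : ZMod q) * DirichletCharacter.LFunction (χ₁ * χ₂)⁻¹ m₃) := by ring
        _ = _ := by
          rw [e₁, e₂, e₃, pow_add, pow_add]
          have hq : (q : ℂ) ≠ 0 := by exact_mod_cast NeZero.ne q
          field_simp
          ring
    · rw [sum_mul_dft_bernoulliZMod_eq_zero h₂]; simp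
  · simp [sum_mul_dft_bernoulliZMod_eq_zero h₁]

theorem tripleMean_eq_sum_divisors {q m₁ m₂ m₃ a b c : ℕ} [NeZero q] (hm₁ : 1 ≤ m₁)
    (hm₂ : 1 ≤ m₂) (hm₃ : 1 ≤ m₃) (hpar : m₁ + m₂ ≡ m₃ [MOD 2])
    (haq : a.Coprime q) (hbq : b.Coprime q) (hcq : c.Coprime q) :
    tripleMean q m₁ m₂ m₃ a b c =
      -((2 * Real.pi * Complex.I) ^ (m₁ + m₂ + m₃) * (-1) ^ m₃ * (q.totient : ℂ) ^ 2 /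
        (8 * m₁.factorial * m₂.factorial * m₃.factorial * (q : ℂ) ^ (m₁ + m₂ + m₃))) *
      ((∑ d ∈ q.divisors, (ArithmeticFunction.moebius (q / d) : ℝ) *
        ((d : ℝ) ^ (m₁ + m₂ + m₃ - 2) * tripleDedekindSum m₁ m₂ m₃ a b c d) : ℝ) : ℂ) := by
  have hq : (q : ℂ) ≠ 0 := by exact_mod_cast NeZero.ne q
  rw [tripleMean_eq_sum_characters hm₁ hm₂ hm₃ hpar haq hbq hcq, sum_sum_characters_eq,
    sum_ite_isUnit_eq_sum_divisors]
  push_cast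
  rw [Finset.mul_sum, Finset.mul_sum, Finset.mul_sum]
  refine Finset.sum_congr rfl fun d hd => ?_
  have hdvd := Nat.dvd_of_mem_divisors hd
  have hd0 : d ≠ 0 := (Nat.pos_of_mem_divisors hd).ne'
  have : NeZero d := ⟨hd0⟩
  set e := q / d with he
  have hqe : q = d * e := (Nat.mul_div_cancel' hdvd).symm
  have heq : e ∣ q := Dvd.intro_left d hqe.symm
  have he0 : e ≠ 0 := by rintro h; rw [h, mul_zero] at hqe; exact NeZero.ne q hqe
  have hd1 : (d : ℂ) ≠ 0 := by exact_mod_cast hd0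
  have he1 : (e : ℂ) ≠ 0 := by exact_mod_cast he0
  have h1 : ∀ t : ℕ,
      ZMod.dft (bernoulliZMod q m₁ a) ((t * e : ℕ) : ZMod q) *
        ZMod.dft (bernoulliZMod q m₂ b) ((t * e : ℕ) : ZMod q) *
        ZMod.dft (bernoulliZMod q m₃ c) ((t * e : ℕ) : ZMod q) =
      (e : ℂ) ^ 3 / (e : ℂ) ^ (m₁ + m₂ + m₃) *
      (ZMod.dft (bernoulliZMod d m₁ a) (t : ZMod d) * ZMod.dft (bernoulliZMod d m₂ b) (t : ZMod d) *
        ZMod.dft (bernoulliZMod d m₃ c) (t : ZMod d)) := fun t => by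
    rw [dft_bernoulliZMod_mul hqe (haq.coprime_dvd_right heq),
      dft_bernoulliZMod_mul hqe (hbq.coprime_dvd_right heq),
      dft_bernoulliZMod_mul hqe (hcq.coprime_dvd_right heq), pow_add, pow_add]
    field_simp
  have h2 := sum_dft_bernoulliZMod (d := d) m₁ m₂ m₃ a b c
  have h3 := sum_zmod_val_eq_sum_range d fun i : ℕ =>
    ZMod.dft (bernoulliZMod d m₁ a) (i : ZMod d) * ZMod.dft (bernoulliZMod d m₂ b) (i : ZMod d) *
        ZMod.dft (bernoulliZMod d m₃ c) (i : ZMod d)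
  simp only [ZMod.natCast_val, ZMod.cast_id', id_eq] at h3
  simp only [← Nat.cast_mul, h1]
  rw [← Finset.mul_sum, ← h3, h2]
  -- With `q = de` and `M + 2` the sum of the `mᵢ`, lowering the level gives `e³/e^(M+2)` and the
  -- convolution gives `d`; divided by `q³` this is `d^M / q^(M+2)`.
  obtain ⟨M, hM⟩ := Nat.exists_eq_add_of_le' (show 2 ≤ m₁ + m₂ + m₃ by omega)
  rw [hM, Nat.add_sub_cancel, hqe]
  push_cast
  simp only [mul_pow, pow_add]
  field_simp

theorem neg_one_zpow_half_sub (m₁ m₂ m₃ N : ℕ) (h : m₁ + m₂ + m₃ = 2 * N) :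
    (-1 : ℝ) ^ (((m₁ : ℤ) - m₂ - m₃) / 2) = (-1) ^ N * (-1) ^ (m₂ + m₃) ∧
    (-1 : ℝ) ^ (((m₁ : ℤ) + m₂ - m₃) / 2) = (-1) ^ N * (-1) ^ m₃ := by
  have h0 : ∀ k : ℕ, (-1 : ℝ) ^ (-(k : ℤ)) = (-1) ^ k := fun k => by
    rw [zpow_neg, zpow_natCast, ← inv_pow]; norm_num
  have h1 : ((m₁ : ℤ) - m₂ - m₃) / 2 = N + -((m₂ + m₃ : ℕ) : ℤ) := by push_cast; omega
  have h2 : ((m₁ : ℤ) + m₂ - m₃) / 2 = N + -(m₃ : ℤ) := by omega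
  rw [h1, h2, zpow_add₀ (by norm_num), zpow_add₀ (by norm_num), h0, h0, zpow_natCast]
  exact ⟨rfl, rfl⟩

theorem sum_moebius_tripleDedekindSum {q m₁ m₂ m₃ a b c : ℕ} (hq : 2 ≤ q) (hm₁ : 1 ≤ m₁)
    (hm₂ : 1 ≤ m₂) (hm₃ : 2 ≤ m₃) (hpar : m₁ + m₂ ≡ m₃ [MOD 2])
    (ha : 1 ≤ a) (hb : 1 ≤ b) (hc : 1 ≤ c)
    (haq : a.Coprime q) (hbq : b.Coprime q) (hcq : c.Coprime q) :
    ∑ d ∈ q.divisors, (ArithmeticFunction.moebius (q / d) : ℝ) *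
        ((d : ℝ) ^ (m₁ + m₂ + m₃ - 2) * tripleDedekindSum m₁ m₂ m₃ a b c d) =
      (sumA m₁ m₂ m₃ q a b c + (-1 : ℝ) ^ m₁ * sumA m₁ m₃ m₂ q a c b +
            sumB m₁ m₂ m₃ q a b c + (-1 : ℝ) ^ m₁ * sumB m₁ m₃ m₂ q a c b +
            sumC m₁ m₂ m₃ q a b c + (-1 : ℝ) ^ m₁ * sumC m₁ m₃ m₂ q a c b -
            sumD m₁ m₂ m₃ q b c + sumD m₁ m₃ m₂ q c b +
            constC₂ m₁ m₂ m₃ q a b c) -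
      (-1) ^ m₂ * ((m₂.factorial : ℝ) * m₃.factorial / (m₂ + m₃).factorial) *
        ((b.gcd c : ℝ) ^ (m₂ + m₃) / ((b : ℝ) ^ m₃ * (c : ℝ) ^ m₂)) *
        (sumR m₁ (m₂ + m₃) q a (b * c / b.gcd c) + sumR (m₂ + m₃) m₁ q (b * c / b.gcd c) a) := by
  have hg0 : 0 < b.gcd c := Nat.gcd_pos_of_pos_left c hb
  have hgdvd : b.gcd c ∣ b * c := (Nat.gcd_dvd_left b c).mul_right c
  have hL : b * c / b.gcd c ≠ 0 :=
    (Nat.div_pos (Nat.le_of_dvd (Nat.mul_pos hb hc) hgdvd) hg0).ne'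
  -- This identifies the gcd in `C₂` with the one coming from the last reciprocity step, where the
  -- modulus `bc/gcd(b, c)` appears.
  have hgcd : (a * b.gcd c).gcd (b * c) = a.gcd (b * c / b.gcd c) * b.gcd c := by
    rw [← Nat.gcd_mul_right, Nat.div_mul_cancel hgdvd]
  have hLR : ((b * c / b.gcd c : ℕ) : ℝ) = b * c / b.gcd c := by
    rw [Nat.cast_div hgdvd (by exact_mod_cast hg0.ne'), Nat.cast_mul]
  have hB : bernoulliBar (m₁ + (m₂ + m₃)) 0 = (bernoulli (m₁ + m₂ + m₃) : ℝ) := by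
    rw [bernoulliBar_of_ne_one (by omega), Int.fract_zero, bernoulliFun_eval_zero, add_assoc]
  have hC : constC₂ m₁ m₂ m₃ q a b c =
      (-1) ^ m₂ * ((m₂.factorial : ℝ) * m₃.factorial / (m₂ + m₃).factorial) *
        ((b.gcd c : ℝ) ^ (m₂ + m₃) / ((b : ℝ) ^ m₃ * (c : ℝ) ^ m₂)) *
        (jordanJ (m₁ + (m₂ + m₃)) q *
          ((-1) ^ m₁ * ((m₁.factorial : ℝ) * (m₂ + m₃).factorial / (m₁ + (m₂ + m₃)).factorial) *
          ((a.gcd (b * c / b.gcd c) : ℝ) ^ (m₁ + (m₂ + m₃)) /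
            ((a : ℝ) ^ (m₂ + m₃) * ((b * c / b.gcd c : ℕ) : ℝ) ^ m₁)) *
          bernoulliBar (m₁ + (m₂ + m₃)) 0)) := by
    rw [constC₂, hgcd, hB, hLR, Nat.cast_mul, ← add_assoc]
    have h1 : (b.gcd c : ℝ) ≠ 0 := by exact_mod_cast hg0.ne'
    have h2 : (b : ℝ) ≠ 0 := by positivity
    have h3 : (c : ℝ) ≠ 0 := by positivity
    have h4 : (a : ℝ) ≠ 0 := by positivity
    simp only [pow_add, mul_pow, div_pow]
    field_simp
  have hterm : ∀ d ∈ q.divisors, (ArithmeticFunction.moebius (q / d) : ℝ) *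
        ((d : ℝ) ^ (m₁ + m₂ + m₃ - 2) * tripleDedekindSum m₁ m₂ m₃ a b c d) = _ := fun d hd => by
    have hdvd := Nat.dvd_of_mem_divisors hd
    rw [tripleDedekindSum_reciprocity hm₁ hm₂ hm₃ hpar (by omega) (by omega) (by omega)
      (Nat.pos_of_mem_divisors hd).ne' (haq.coprime_dvd_right hdvd) (hbq.coprime_dvd_right hdvd)
      (hcq.coprime_dvd_right hdvd)]
  have hJ := sum_divisors_moebius_div_mul_pow (q := q) (by omega) (m₁ + (m₂ + m₃))
  have hZ := sum_divisors_moebius_div_eq_zero hq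
  rw [Finset.sum_congr rfl hterm, hC, ← hJ, sumA_eq_sum_sliceA, sumA_eq_sum_sliceA,
    sumB_eq_sum_sliceB, sumB_eq_sum_sliceB, sumC_eq_sum_sliceC, sumC_eq_sum_sliceC,
    sumD_eq_sum_sliceD, sumD_eq_sum_sliceD, sumR_eq_sum_reciprocitySum _ _ _ _ hL,
    sumR_eq_sum_reciprocitySum _ _ _ _ (show a ≠ 0 by omega)]
  -- The zero is inserted as the part independent of `d` times `∑ μ(q/d) = 0`, so that both sides
  -- can be compared divisor by divisor.
  rw [← zero_add (_ - _ : ℝ), ← mul_zero (constantPart m₁ m₂ m₃ b c +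
    (-1) ^ m₁ * constantPart m₁ m₃ m₂ c b), ← hZ]
  simp only [Finset.mul_sum, Finset.sum_mul, ← Finset.sum_add_distrib, ← Finset.sum_sub_distrib]
  exact Finset.sum_congr rfl fun d _ => by ring

theorem theorem2p4 (q m₁ m₂ m₃ a b c : ℕ) [NeZero q] (hq : 2 ≤ q)
    (hm₁ : 1 ≤ m₁) (hm₂ : 1 ≤ m₂) (hm₃ : 2 ≤ m₃) (hpar : m₁ + m₂ ≡ m₃ [MOD 2])
    (ha : 1 ≤ a) (hb : 1 ≤ b) (hc : 1 ≤ c)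
    (haq : a.Coprime q) (hbq : b.Coprime q) (hcq : c.Coprime q) :
    tripleMean q m₁ m₂ m₃ a b c =
      (((-1 : ℝ) ^ (((m₁ : ℤ) - m₂ - m₃) / 2) * (2 * Real.pi) ^ (m₁ + m₂ + m₃) *
            (b.gcd c : ℝ) ^ (m₂ + m₃) * (q.totient : ℝ) ^ 2 /
            (8 * (q : ℝ) ^ (m₁ + m₂ + m₃) * (b : ℝ) ^ m₃ * (c : ℝ) ^ m₂ *
              (m₁.factorial : ℝ) * ((m₂ + m₃).factorial : ℝ)) *
          (sumR m₁ (m₂ + m₃) q a (b * c / b.gcd c) + sumR (m₂ + m₃) m₁ q (b * c / b.gcd c) a) -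
        (-1 : ℝ) ^ (((m₁ : ℤ) + m₂ - m₃) / 2) * (2 * Real.pi) ^ (m₁ + m₂ + m₃) *
            (q.totient : ℝ) ^ 2 /
            (8 * (q : ℝ) ^ (m₁ + m₂ + m₃) *
              (m₁.factorial : ℝ) * (m₂.factorial : ℝ) * (m₃.factorial : ℝ)) *
          (sumA m₁ m₂ m₃ q a b c + (-1 : ℝ) ^ m₁ * sumA m₁ m₃ m₂ q a c b +
            sumB m₁ m₂ m₃ q a b c + (-1 : ℝ) ^ m₁ * sumB m₁ m₃ m₂ q a c b +
            sumC m₁ m₂ m₃ q a b c + (-1 : ℝ) ^ m₁ * sumC m₁ m₃ m₂ q a c b -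
            sumD m₁ m₂ m₃ q b c + sumD m₁ m₃ m₂ q c b +
            constC₂ m₁ m₂ m₃ q a b c) : ℝ) : ℂ) := by
  obtain ⟨N, hN⟩ : ∃ N, m₁ + m₂ + m₃ = 2 * N :=
    ⟨(m₁ + m₂ + m₃) / 2, by unfold Nat.ModEq at hpar; omega⟩
  obtain ⟨hs₁, hs₂⟩ := neg_one_zpow_half_sub m₁ m₂ m₃ N hN
  have hI : (2 * (Real.pi : ℂ) * Complex.I) ^ (m₁ + m₂ + m₃) =
      (((-1) ^ N * (2 * Real.pi) ^ (m₁ + m₂ + m₃) : ℝ) : ℂ) := by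
    rw [mul_pow _ Complex.I, hN, pow_mul Complex.I, Complex.I_sq]
    push_cast
    ring
  rw [tripleMean_eq_sum_divisors hm₁ hm₂ (by omega) hpar haq hbq hcq,
    sum_moebius_tripleDedekindSum hq hm₁ hm₂ hm₃ hpar ha hb hc haq hbq hcq, hs₁, hs₂, hI]
  generalize sumR m₁ (m₂ + m₃) q a (b * c / b.gcd c) +
    sumR (m₂ + m₃) m₁ q (b * c / b.gcd c) a = R
  generalize sumA m₁ m₂ m₃ q a b c + (-1 : ℝ) ^ m₁ * sumA m₁ m₃ m₂ q a c b +
    sumB m₁ m₂ m₃ q a b c + (-1 : ℝ) ^ m₁ * sumB m₁ m₃ m₂ q a c b +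
    sumC m₁ m₂ m₃ q a b c + (-1 : ℝ) ^ m₁ * sumC m₁ m₃ m₂ q a c b -
    sumD m₁ m₂ m₃ q b c + sumD m₁ m₃ m₂ q c b + constC₂ m₁ m₂ m₃ q a b c = X
  have hqC : (q : ℂ) ≠ 0 := by exact_mod_cast (by omega : q ≠ 0)
  have hbC : (b : ℂ) ≠ 0 := by exact_mod_cast (by omega : b ≠ 0)
  have hcC : (c : ℂ) ≠ 0 := by exact_mod_cast (by omega : c ≠ 0)
  have h₁ : (m₁.factorial : ℂ) ≠ 0 := by exact_mod_cast m₁.factorial_ne_zero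
  have h₂ : (m₂.factorial : ℂ) ≠ 0 := by exact_mod_cast m₂.factorial_ne_zero
  have h₃ : (m₃.factorial : ℂ) ≠ 0 := by exact_mod_cast m₃.factorial_ne_zero
  have h₄ : ((m₂ + m₃).factorial : ℂ) ≠ 0 := by exact_mod_cast (m₂ + m₃).factorial_ne_zero
  push_cast
  generalize (-1 : ℂ) ^ N = s
  generalize (2 * (Real.pi : ℂ)) ^ (m₁ + m₂ + m₃) = t
  generalize (q : ℂ) ^ (m₁ + m₂ + m₃) = u
  rw [pow_add (-1 : ℂ)]
  field_simp
  ring
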